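/- Let $(\mathcal Y,\mathcal A)$ be a measurable space, $\mathcal P(\mathcal Y)$ the set of probability measures on it, $\mathcal W\subseteq\mathcal P(\mathcal Y)$ non-empty, and $\alpha\in(0,\infty]$. A prior is a finitely supported probability mass function $P$ on $\mathcal W$; sums and maxima over $W$ below run over the support of $P$. Definitions. For probability measures $W,Q$ on a common measurable space with a common dominating $\sigma$-finite measure $\nu$, the Rényi divergence is $$D_\alpha(W\|Q)=\begin{cases}\frac1{\alpha-1}\ln\int\left(\frac{dW}{d\nu}\right)^{\alpha}\left(\frac{dQ}{d\nu}\right)^{1-\alpha}d\nu&\alpha\in(0,\infty)\setminus\{1\},\\[2pt] \int\frac{dW}{d\nu}\left(\ln\frac{dW}{d\nu}-\ln\frac{dQ}{d\nu}\right)d\nu&\alpha=1,\\[2pt] \ln\operatorname{ess\,sup}_\nu\frac{dW/d\nu}{dQ/d\nu}&\alpha=\infty.\end{cases}$$ For a prior $P$ and a $\sigma$-finite measure $\nu$ dominating the elements of its support, the mean measure $\mu_{\alpha,P}$ has $\nu$-density $\left(\sum_W P(W)(dW/d\nu)^\alpha\right)^{1/\alpha}$ for $\alpha<\infty$ and $\max_{W}dW/d\nu$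 for $\alpha=\infty$. (None of these depend on $\nu$.) The Rényi information is $$I_\alpha(P;\mathcal W)=\begin{cases}\frac{\alpha}{\alpha-1}\ln\mu_{\alpha,P}(\mathcal Y)&\alpha\in(0,\infty)\setminus\{1\},\\[2pt] \int\sum_W p(W|y)\ln\frac{p(W|y)}{P(W)}\,\mu_{1,P}(dy),\quad p(W|y)=P(W)\frac{dW}{d\mu_{1,P}}(y)&\alpha=1,\\[2pt] \ln\mu_{\infty,P}(\mathcal Y)&\alpha=\infty,\end{cases}$$ the Rényi mean is $q_{\alpha,P}=\mu_{\alpha,P}/\mu_{\alpha,P}(\mathcal Y)$, and the Rényi capacity is $C_{\alpha,\mathcal W}=\sup_P I_\alpha(P;\mathcal W)$. $P\circledast\mathcal W$ denotes the probability measure on $\operatorname{supp}P\times\mathcal Y$ with marginal $P$ on $\operatorname{supp}P$ and conditional distribution $W$ given $W\in\operatorname{supp}P$. The total variation norm is $\|\mu\|=\sup_{E\in\mathcal A}\left(\mu(E)-\mu(\mathcal Y\setminus E)\right)$. Theorem. In $[-\infty,\infty]$, $$C_{\alpha,\mathcal W}=\sup_P\inf_{Q\in\mathcal P(\mathcal Y)}D_\alpha(P\circledast\mathcal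 W\|P\otimes Q)=\inf_{Q\in\mathcal P(\mathcal Y)}\sup_P D_\alpha(P\circledast\mathcal W\|P\otimes Q)=\inf_{Q\in\mathcal P(\mathcal Y)}\sup_{W\in\mathcal W}D_\alpha(W\|Q).$$ If $C_{\alpha,\mathcal W}<\infty$, there is a unique $q_{\alpha,\mathcal W}\in\mathcal P(\mathcal Y)$, the Rényi center, such that $$C_{\alpha,\mathcal W}=\sup_P D_\alpha(P\circledast\mathcal W\|P\otimes q_{\alpha,\mathcal W})=\sup_{W\in\mathcal W}D_\alpha(W\|q_{\alpha,\mathcal W});$$ moreover, each of these two expressions for the capacity by itself already determines $q_{\alpha,\mathcal W}$ uniquely. Furthermore, for every sequence of priors $(P_n)$ with $\lim_n I_\alpha(P_n;\mathcal W)=C_{\alpha,\mathcal W}$, the Rényi means $(q_{\alpha,P_n})$ form a Cauchy sequence in $\mathcal P(\mathcal Y)$ for the total variation metric, and $q_{\alpha,\mathcal W}$ is its unique limit. -/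

import Mathlib

open MeasureTheory ProbabilityTheory Filter Topology
open scoped ENNReal NNReal

noncomputable section

namespace Renyi

/-! ### Rényi divergence -/

section Divergence

variable {Ω : Type*} [MeasurableSpace Ω]

/-- The Rényi divergence `D_α(W‖Q)` of positive order `α ∈ (0,∞]` between probability measures.
The Radon–Nikodym derivatives are taken with respect to the common dominating measure `W + Q`
(the value does not depend on the dominating measure).  In order one it is the
Kullback–Leibler divergence.  The conventions `0 ^ (1 - α) = ∞` for `α > 1`, `c / 0 = ∞` for
`c > 0`, `log 0 = -∞` and `log ∞ = ∞` are those of `ℝ≥0∞` and `EReal`. -/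
def renyiDiv (α : ℝ≥0∞) (W Q : ProbabilityMeasure Ω) : EReal :=
  let ρ : Measure Ω := (W : Measure Ω) + (Q : Measure Ω)
  let f : Ω → ℝ≥0∞ := (W : Measure Ω).rnDeriv ρ
  let g : Ω → ℝ≥0∞ := (Q : Measure Ω).rnDeriv ρ
  if α = ∞ then ENNReal.log (essSup (fun y => f y / g y) ρ)
  else if α = 1 then
    ((InformationTheory.klDiv (W : Measure Ω) (Q : Measure Ω) : ℝ≥0∞) : EReal)
  else ((1 / (α.toReal - 1) : ℝ) : EReal) *
    ENNReal.log (∫⁻ y, f y ^ α.toReal * g y ^ (1 - α.toReal) ∂ρ)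

/-- The total variation distance `‖W - Q‖ = sup_E (W - Q)(E) - (W - Q)(Ω \ E)`, the supremum
being over measurable sets. -/
def tvDist (W Q : ProbabilityMeasure Ω) : ℝ :=
  ⨆ E : {E : Set Ω // MeasurableSet E},
    (((W : Measure Ω).real E - (Q : Measure Ω).real E)
      - ((W : Measure Ω).real (E : Set Ω)ᶜ - (Q : Measure Ω).real (E : Set Ω)ᶜ))

end Divergence

/-! ### Priors, mean measures, Rényi information -/

variable {Y : Type*} [MeasurableSpace Y] {𝒲 : Set (ProbabilityMeasure Y)}

/-- Finitely supported probability mass functions on `𝒲`; `P.weights w` is the mass of `w`. -/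
abbrev Prior (𝒲 : Set (ProbabilityMeasure Y)) : Type _ := Convexity.StdSimplex ℝ≥0 𝒲

/-- The order one mean measure, that is the mixture `∑ P(w) w`. -/
def mixture (P : Prior 𝒲) : Measure Y :=
  ∑ w ∈ P.weights.support, P.weights w • ((w : ProbabilityMeasure Y) : Measure Y)

/-- The density with respect to the mixture of a measure `w` in the support of the prior. -/
def density (P : Prior 𝒲) (w : 𝒲) : Y → ℝ≥0∞ :=
  ((w : ProbabilityMeasure Y) : Measure Y).rnDeriv (mixture P)

/-- The weighted power mean of order `α` of the densities. -/
def meanDensity (α : ℝ≥0∞) (P : Prior 𝒲) (y : Y) : ℝ≥0∞ :=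
  if α = ∞ then ⨆ w ∈ P.weights.support, density P w y
  else (∑ w ∈ P.weights.support, (P.weights w : ℝ≥0∞) * density P w y ^ α.toReal)
    ^ (1 / α.toReal)

/-- The mean measure of positive order `α` for the prior `P`, with the mixture as reference measure
(the mean measure does not depend on the reference measure). -/
def meanMeasure (α : ℝ≥0∞) (P : Prior 𝒲) : Measure Y :=
  (mixture P).withDensity (meanDensity α P)

/-- The order one posterior probability of `w` given the output `y`. -/
def posterior (P : Prior 𝒲) (w : 𝒲) (y : Y) : ℝ :=
  (P.weights w : ℝ) * (density P w y).toReal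

/-- The Rényi information `I_α(P;𝒲)` of positive order `α` for the prior `P`. -/
def renyiInfo (α : ℝ≥0∞) (P : Prior 𝒲) : EReal :=
  if α = ∞ then ENNReal.log (meanMeasure ∞ P Set.univ)
  else if α = 1 then
    ((∫ y, ∑ w ∈ P.weights.support,
      posterior P w y * Real.log (posterior P w y / P.weights w) ∂(mixture P) : ℝ) : EReal)
  else ((α.toReal / (α.toReal - 1) : ℝ) : EReal) * ENNReal.log (meanMeasure α P Set.univ)

/-- The Rényi capacity of order `α` of `𝒲`. -/
def renyiCapacity (α : ℝ≥0∞) (𝒲 : Set (ProbabilityMeasure Y)) : EReal :=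
  ⨆ P : Prior 𝒲, renyiInfo α P

instance (P : Prior 𝒲) : IsFiniteMeasure (mixture P) := by
  unfold mixture; infer_instance

lemma smul_le_mixture (P : Prior 𝒲) {w : 𝒲} (hw : w ∈ P.weights.support) :
    P.weights w • ((w : ProbabilityMeasure Y) : Measure Y) ≤ mixture P := by
  classical
  rw [mixture, ← Finset.add_sum_erase _ _ hw]
  exact Measure.le_add_right le_rfl

lemma absolutelyContinuous_mixture (P : Prior 𝒲) {w : 𝒲} (hw : w ∈ P.weights.support) :
    ((w : ProbabilityMeasure Y) : Measure Y) ≪ mixture P := by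
  have h0 : (P.weights w : ℝ≥0∞) ≠ 0 := by simpa using hw
  exact (Measure.absolutelyContinuous_smul h0).trans
    (Measure.absolutelyContinuous_of_le (smul_le_mixture P hw))

lemma measurable_density (P : Prior 𝒲) (w : 𝒲) : Measurable (density P w) :=
  Measure.measurable_rnDeriv _ _

lemma measurable_meanDensity (α : ℝ≥0∞) (P : Prior 𝒲) : Measurable (meanDensity α P) := by
  unfold meanDensity
  split_ifs
  · exact Measurable.biSup _ (Finset.countable_toSet _) fun w _ => measurable_density P w
  · refine Measurable.pow_const (Finset.measurable_fun_sum _ fun w _ => ?_) _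
    exact ((measurable_density P w).pow_const _).const_mul _

/-- The order one mean measure is the mixture. -/
lemma meanMeasure_one (P : Prior 𝒲) : meanMeasure 1 P = mixture P := by
  have h : meanDensity 1 P
      = ∑ w ∈ P.weights.support, (P.weights w : ℝ≥0∞) • density P w := by
    ext y; simp [meanDensity, Finset.sum_apply]
  have h2 : ∀ s ⊆ P.weights.support,
      (mixture P).withDensity (∑ w ∈ s, (P.weights w : ℝ≥0∞) • density P w)
        = ∑ w ∈ s, P.weights w • ((w : ProbabilityMeasure Y) : Measure Y) := by
    classical
    intro s
    induction s using Finset.induction_on with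
    | empty => intro _; simp
    | insert a s ha ih =>
      intro hs
      rw [Finset.sum_insert ha, Finset.sum_insert ha,
        withDensity_add_left ((measurable_density P a).const_smul _),
        ih ((Finset.subset_insert _ _).trans hs), withDensity_smul _ (measurable_density P a)]
      congr 1
      unfold density
      rw [Measure.withDensity_rnDeriv_eq _ _
        (absolutelyContinuous_mixture P (hs (Finset.mem_insert_self _ _)))]
      rfl
  rw [meanMeasure, h, h2 _ subset_rfl, mixture]

lemma density_le (P : Prior 𝒲) {w : 𝒲} (hw : w ∈ P.weights.support) :
    ∀ᵐ y ∂(mixture P), density P w y ≤ (P.weights w : ℝ≥0∞)⁻¹ := by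
  have h0 : (P.weights w : ℝ≥0∞) ≠ 0 := by simpa using hw
  have h1 := Measure.rnDeriv_le_one_of_le (smul_le_mixture P hw)
  have h2 := Measure.rnDeriv_smul_left ((w : ProbabilityMeasure Y) : Measure Y)
    (mixture P) (P.weights w)
  filter_upwards [h1, h2] with y h1 h2
  rw [h2] at h1
  rw [ENNReal.le_inv_iff_mul_le, mul_comm]
  simpa [density, ENNReal.smul_def] using h1

lemma sum_weights (P : Prior 𝒲) :
    ∑ w ∈ P.weights.support, (P.weights w : ℝ≥0∞) = 1 := by
  have h := P.total
  rw [Finsupp.sum] at h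
  exact_mod_cast h

lemma meanMeasure_univ_ne_top (α : ℝ≥0∞) (P : Prior 𝒲) : meanMeasure α P Set.univ ≠ ∞ := by
  have hM : (∑ w ∈ P.weights.support, (P.weights w : ℝ≥0∞)⁻¹) + 1 ≠ ∞ := by
    refine ENNReal.add_ne_top.2 ⟨ENNReal.sum_ne_top.2 fun w hw => ?_, ENNReal.one_ne_top⟩
    simpa using hw
  set M := (∑ w ∈ P.weights.support, (P.weights w : ℝ≥0∞)⁻¹) + 1 with hMdef
  have hd : ∀ᵐ y ∂(mixture P), ∀ w ∈ P.weights.support, density P w y ≤ M := by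
    refine (Filter.eventually_all_finset _).2 fun w hw => ?_
    filter_upwards [density_le P hw] with y hy
    refine hy.trans ((Finset.single_le_sum
      (f := fun w => (P.weights w : ℝ≥0∞)⁻¹) (fun _ _ => zero_le) hw).trans le_self_add)
  have hle : ∀ᵐ y ∂(mixture P), meanDensity α P y ≤ M := by
    filter_upwards [hd] with y hy
    unfold meanDensity
    split_ifs with h
    · exact iSup₂_le hy
    · rcases eq_or_ne α.toReal 0 with h0 | h0
      · simp [h0, hMdef]
      · have hpos : 0 < α.toReal := lt_of_le_of_ne ENNReal.toReal_nonneg h0.symm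
        have : ∑ w ∈ P.weights.support, (P.weights w : ℝ≥0∞) * density P w y ^ α.toReal
            ≤ M ^ α.toReal := by
          calc _ ≤ ∑ w ∈ P.weights.support, (P.weights w : ℝ≥0∞) * M ^ α.toReal := by
                gcongr with w hw
                exact hy w hw
            _ = _ := by rw [← Finset.sum_mul, sum_weights, one_mul]
        calc _ ≤ (M ^ α.toReal) ^ (1 / α.toReal) := by gcongr
          _ = M := by rw [← ENNReal.rpow_mul, mul_one_div_cancel h0, ENNReal.rpow_one]
  rw [meanMeasure, withDensity_apply _ MeasurableSet.univ, Measure.restrict_univ]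
  refine ((lintegral_mono_ae hle).trans_lt ?_).ne
  rw [lintegral_const]
  exact ENNReal.mul_lt_top hM.lt_top (measure_lt_top _ _)

lemma meanMeasure_univ_ne_zero (α : ℝ≥0∞) (P : Prior 𝒲) : meanMeasure α P Set.univ ≠ 0 := by
  intro h
  obtain ⟨w, hw⟩ := P.support_weights_nonempty
  have hp : (P.weights w : ℝ≥0∞) ≠ 0 := by simpa using hw
  rw [meanMeasure, withDensity_apply _ MeasurableSet.univ, Measure.restrict_univ,
    lintegral_eq_zero_iff (measurable_meanDensity α P)] at h
  have h0 : density P w =ᵐ[mixture P] 0 := by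
    filter_upwards [h] with y hy
    unfold meanDensity at hy
    split_ifs at hy with hα
    · rw [Pi.zero_apply, ← bot_eq_zero, iSup₂_eq_bot] at hy
      exact hy w hw
    · rcases eq_or_ne α.toReal 0 with h0 | h0
      · simp [h0] at hy
      · have hpos : 0 < α.toReal := lt_of_le_of_ne ENNReal.toReal_nonneg h0.symm
        rw [Pi.zero_apply, ENNReal.rpow_eq_zero_iff_of_pos (by positivity),
          Finset.sum_eq_zero_iff] at hy
        have := hy w hw
        rw [mul_eq_zero, ENNReal.rpow_eq_zero_iff_of_pos hpos] at this
        exact this.resolve_left hp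
  have h1 := Measure.withDensity_rnDeriv_eq _ _ (absolutelyContinuous_mixture P hw)
  have h2 : (mixture P).withDensity (density P w) = 0 := by
    rw [withDensity_congr_ae h0, withDensity_zero]
  rw [density, h1] at h2
  have h3 := measure_univ (μ := ((w : ProbabilityMeasure Y) : Measure Y))
  simp [h2] at h3

/-- The Rényi mean of positive order `α` for the prior `P`: the normalized mean measure. -/
def renyiMean (α : ℝ≥0∞) (P : Prior 𝒲) : ProbabilityMeasure Y :=
  ⟨(meanMeasure α P Set.univ)⁻¹ • meanMeasure α P, ⟨by
    rw [Measure.smul_apply, smul_eq_mul]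
    exact ENNReal.inv_mul_cancel (meanMeasure_univ_ne_zero α P) (meanMeasure_univ_ne_top α P)⟩⟩

/-! ### The joint measures -/

/-- The support of the prior, with all subsets measurable. -/
def Supp (P : Prior 𝒲) : Type _ := {w : 𝒲 // w ∈ P.weights.support}

instance (P : Prior 𝒲) : MeasurableSpace (Supp P) := ⊤

instance (P : Prior 𝒲) : Fintype (Supp P) :=
  inferInstanceAs (Fintype {w : 𝒲 // w ∈ P.weights.support})

/-- The prior as a probability measure on its support. -/
def priorMeasure (P : Prior 𝒲) : ProbabilityMeasure (Supp P) :=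
  ⟨∑ w : Supp P, P.weights w.1 • Measure.dirac w, ⟨by
    have h := sum_weights P
    rw [← Finset.sum_coe_sort] at h
    rw [Measure.finsetSum_apply]
    simp only [Measure.smul_apply, measure_univ, ENNReal.smul_def, smul_eq_mul, mul_one]
    exact h⟩⟩

/-- The tautological channel: the output distribution given the input `w` is `w` itself. -/
def channel (P : Prior 𝒲) : Kernel (Supp P) Y :=
  ⟨fun w => ((w.1 : ProbabilityMeasure Y) : Measure Y), measurable_from_top⟩

instance (P : Prior 𝒲) : IsMarkovKernel (channel P) :=
  ⟨fun w => inferInstanceAs (IsProbabilityMeasure ((w.1 : ProbabilityMeasure Y) : Measure Y))⟩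

/-- The measure `P ⊛ 𝒲` on `supp P × Y`, whose marginal on `supp P` is `P` and whose conditional
distribution given `w` is `w`. -/
def jointMeasure (P : Prior 𝒲) : ProbabilityMeasure (Supp P × Y) :=
  ⟨(priorMeasure P : Measure (Supp P)) ⊗ₘ channel P, inferInstance⟩

/-- `D_α(P ⊛ 𝒲 ‖ P ⊗ Q)`. -/
def jointDiv (α : ℝ≥0∞) (P : Prior 𝒲) (Q : ProbabilityMeasure Y) : EReal :=
  renyiDiv α (jointMeasure P) ((priorMeasure P).prod Q)

end Renyi

end

open Renyi

/-!
The proof rests on three properties of the Rényi divergence, valid for every order in `(0, ∞]`: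

* the Sibson identity `D(P ⊛ 𝒲 ‖ P ⊗ Q) = I(P) + D(q_P ‖ Q)` (`jointDiv_eq_add`), by which the Rényi
  mean `q_P` minimizes the joint divergence and the minimum is the information;
* a Pinsker type inequality (`exists_tvDist_le_of_renyiDiv_le`) and lower semicontinuity in the
  second argument under convergence in total variation (`renyiDiv_le_of_tendsto`);
* a quantitative form of the dependence of `D(P ⊛ 𝒲 ‖ P ⊗ Q)` on the prior (`exists_mix_prior`):
  if a mixture of `P₁` and `P₂` has joint divergence at most `C` and `P₁` has joint divergence
  almost `C`, then neither `P₁` nor `P₂` exceeds `C` by much.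

Let the capacity `C` be finite, and let `Q` be the mean of a mixture of a nearly optimal prior `P₁`
and a prior `P₂`. The joint divergence of the mixture from `Q` is its information, hence at most
`C`, so the joint divergences of `P₁` and `P₂` from `Q` are at most slightly larger than `C`. By the
Sibson identity `D(q_{P₁} ‖ Q)` is small, and so is `D(q_{P₂} ‖ Q)` when `P₂` is nearly optimal too
(`exists_near_mean`). Therefore the means of a maximizing sequence of priors are Cauchy in total
variation, which is a complete metric (`exists_tendsto_tvDist`). With `P₂` the point mass at `W`,
the same lemma and lower semicontinuity show that the limit `q` satisfies `D(W ‖ q) ≤ C` for all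
`W` in `𝒲`. This gives the minimax equality. Conversely, if all joint divergences from `q` are at
most `C`, the Sibson identity gives `D(q_P ‖ q) ≤ C - I(P)`, so that the means of every maximizing
sequence converge to `q`; this is the uniqueness of the center.

In finite order these properties are read off from the Hellinger divergence, an increasing function
of the Rényi divergence (`renyiDiv_le_coe_iff`) which is the integral of a nonnegative homogeneous
function of the two densities. It does not depend on the reference measure
(`homInt_withDensity`) and is affine in the prior (`homInt_joint`). In infinite order a bound on the
divergence is a domination of measures (`renyiDiv_top_le_coe_iff`).
-/

noncomputable section

namespace Renyi

/-! ### The total variation metric -/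

section TotalVariation

variable {Ω : Type*} [MeasurableSpace Ω]

lemma tvDist_eq_iSup (W Q : ProbabilityMeasure Ω) :
    tvDist W Q = ⨆ E : {E : Set Ω // MeasurableSet E},
      2 * ((W : Measure Ω).real E - (Q : Measure Ω).real E) := by
  unfold tvDist
  congr 1
  ext E
  rw [probReal_compl_eq_one_sub E.2, probReal_compl_eq_one_sub E.2]
  ring

lemma tvDist_le {W Q : ProbabilityMeasure Ω} {c : ℝ}
    (h : ∀ E, MeasurableSet E → 2 * ((W : Measure Ω).real E - (Q : Measure Ω).real E) ≤ c) :
    tvDist W Q ≤ c := by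
  rw [tvDist_eq_iSup]
  have : Nonempty {E : Set Ω // MeasurableSet E} := ⟨⟨∅, MeasurableSet.empty⟩⟩
  exact ciSup_le fun E => h E E.2

lemma le_tvDist (W Q : ProbabilityMeasure Ω) {E : Set Ω} (hE : MeasurableSet E) :
    2 * ((W : Measure Ω).real E - (Q : Measure Ω).real E) ≤ tvDist W Q := by
  rw [tvDist_eq_iSup]
  refine le_ciSup (f := fun E : {E : Set Ω // MeasurableSet E} =>
    2 * ((W : Measure Ω).real E - (Q : Measure Ω).real E)) ⟨2, ?_⟩ ⟨E, hE⟩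
  rintro _ ⟨F, rfl⟩
  have h1 := measureReal_le_one (μ := (W : Measure Ω)) (s := F)
  have h2 := measureReal_nonneg (μ := (Q : Measure Ω)) (s := F)
  dsimp only
  linarith

lemma tvDist_nonneg (W Q : ProbabilityMeasure Ω) : 0 ≤ tvDist W Q := by
  simpa using le_tvDist W Q MeasurableSet.empty

lemma tvDist_triangle (W Q R : ProbabilityMeasure Ω) :
    tvDist W R ≤ tvDist W Q + tvDist Q R :=
  tvDist_le fun E hE => by linarith [le_tvDist W Q hE, le_tvDist Q R hE]

lemma tvDist_comm (W Q : ProbabilityMeasure Ω) : tvDist W Q = tvDist Q W := by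
  have key : ∀ W Q : ProbabilityMeasure Ω, tvDist W Q ≤ tvDist Q W := fun W Q =>
    tvDist_le fun E hE => by
      have := le_tvDist Q W hE.compl
      rw [probReal_compl_eq_one_sub hE, probReal_compl_eq_one_sub hE] at this
      linarith
  exact le_antisymm (key _ _) (key _ _)

lemma abs_real_sub_le_tvDist (W Q : ProbabilityMeasure Ω) {E : Set Ω} (hE : MeasurableSet E) :
    |(W : Measure Ω).real E - (Q : Measure Ω).real E| ≤ tvDist W Q := by
  have h1 := le_tvDist W Q hE
  have h2 := le_tvDist Q W hE
  have h3 := tvDist_nonneg W Q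
  rw [tvDist_comm Q W] at h2
  rw [abs_le]
  constructor <;> linarith

lemma eq_of_tvDist_eq_zero {W Q : ProbabilityMeasure Ω} (h : tvDist W Q = 0) : W = Q := by
  refine Subtype.ext (Measure.ext fun E hE => ?_)
  change (W : Measure Ω) E = (Q : Measure Ω) E
  have h1 := abs_real_sub_le_tvDist W Q hE
  rw [h, abs_nonpos_iff, sub_eq_zero] at h1
  exact (measureReal_eq_measureReal_iff (measure_ne_top _ _) (measure_ne_top _ _)).1 h1

/-- The probability measures are complete for the total variation metric: the values on each
measurable set converge, uniformly in the set, so that the limit is again countably additive. -/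
lemma exists_tendsto_tvDist {q : ℕ → ProbabilityMeasure Ω}
    (hq : ∀ ε > 0, ∃ N, ∀ m ≥ N, ∀ n ≥ N, tvDist (q m) (q n) < ε) :
    ∃ Q : ProbabilityMeasure Ω, Tendsto (fun n => tvDist (q n) Q) atTop (𝓝 0) := by
  have hlim : ∀ E : Set Ω, ∃ l : ℝ, MeasurableSet E →
      Tendsto (fun n => (q n : Measure Ω).real E) atTop (𝓝 l) := by
    intro E
    by_cases hE : MeasurableSet E
    · have : CauchySeq fun n => (q n : Measure Ω).real E := by
        refine Metric.cauchySeq_iff.2 fun ε hε => ?_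
        obtain ⟨N, hN⟩ := hq ε hε
        exact ⟨N, fun m hm n hn =>
          (abs_real_sub_le_tvDist (q m) (q n) hE).trans_lt (hN m hm n hn)⟩
      obtain ⟨l, hl⟩ := cauchySeq_tendsto_of_complete this
      exact ⟨l, fun _ => hl⟩
    · exact ⟨0, fun h => absurd h hE⟩
  choose L hL using hlim
  have hunif : ∀ ε > 0, ∃ N, ∀ n ≥ N, ∀ E, MeasurableSet E →
      |(q n : Measure Ω).real E - L E| ≤ ε := by
    intro ε hε
    obtain ⟨N, hN⟩ := hq ε hε
    refine ⟨N, fun n hn E hE => ?_⟩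
    refine le_of_tendsto ((tendsto_const_nhds.sub (hL E hE)).abs) ?_
    filter_upwards [eventually_ge_atTop N] with m hm
    exact (abs_real_sub_le_tvDist (q n) (q m) hE).trans (hN n hn m hm).le
  have hnonneg : ∀ E, MeasurableSet E → 0 ≤ L E := fun E hE =>
    ge_of_tendsto' (hL E hE) fun n => measureReal_nonneg
  have hempty : L ∅ = 0 :=
    tendsto_nhds_unique (hL ∅ .empty) (by simp)
  have huniv : L Set.univ = 1 :=
    tendsto_nhds_unique (hL _ .univ) (by simp)
  have hunion : ∀ E F, MeasurableSet E → MeasurableSet F → Disjoint E F →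
      L (E ∪ F) = L E + L F := by
    intro E F hE hF hd
    refine tendsto_nhds_unique (hL _ (hE.union hF)) (((hL E hE).add (hL F hF)).congr fun n => ?_)
    rw [measureReal_union hd hF]
  have hiUnion : ∀ ⦃f : ℕ → Set Ω⦄ (hf : ∀ i, MeasurableSet (f i)),
      Pairwise (Function.onFun Disjoint f) →
      ENNReal.ofReal (L (⋃ i, f i)) = ∑' i, ENNReal.ofReal (L (f i)) := by
    intro f hf hd
    have hS : ∀ N, MeasurableSet (⋃ i ∈ Finset.range N, f i) := fun N =>
      Finset.measurableSet_biUnion _ fun i _ => hf i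
    have hpart : ∀ N, ∑ i ∈ Finset.range N, ENNReal.ofReal (L (f i))
        = ENNReal.ofReal (L (⋃ i ∈ Finset.range N, f i)) := by
      intro N
      induction N with
      | zero => simp [hempty]
      | succ N ih =>
        have hdis : Disjoint (f N) (⋃ i ∈ Finset.range N, f i) := by
          simp only [Set.disjoint_iUnion_right, Finset.mem_range]
          intro i hi
          exact hd hi.ne'
        rw [Finset.sum_range_succ, ih, Finset.range_add_one, Finset.set_biUnion_insert,
          hunion _ _ (hf N) (hS N) hdis, ENNReal.ofReal_add (hnonneg _ (hf N)) (hnonneg _ (hS N)),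
          add_comm]
    have hSt : Tendsto (fun N => L (⋃ i ∈ Finset.range N, f i)) atTop (𝓝 (L (⋃ i, f i))) := by
      refine Metric.tendsto_atTop.2 fun ε hε => ?_
      obtain ⟨n, hn⟩ := hunif (ε / 4) (by positivity)
      have hn := hn n le_rfl
      have hcont : Tendsto (fun N => (q n : Measure Ω).real (⋃ i ∈ Finset.range N, f i)) atTop
          (𝓝 ((q n : Measure Ω).real (⋃ i, f i))) := by
        have h : Tendsto (fun N => ∑ i ∈ Finset.range N, (q n : Measure Ω) (f i)) atTop
            (𝓝 ((q n : Measure Ω) (⋃ i, f i))) := by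
          rw [measure_iUnion hd hf]
          exact ENNReal.tendsto_nat_tsum _
        refine ((ENNReal.tendsto_toReal (measure_ne_top _ _)).comp h).congr fun N => ?_
        rw [measureReal_def, measure_biUnion_finset (fun i _ j _ hij => hd hij) (fun i _ => hf i)]
        rfl
      obtain ⟨N, hN⟩ := Metric.tendsto_atTop.1 hcont (ε / 4) (by positivity)
      refine ⟨N, fun k hk => ?_⟩
      have h1 := hN k hk
      have h2 := hn _ (hS k)
      have h3 := hn _ (MeasurableSet.iUnion hf)
      rw [Real.dist_eq] at h1 ⊢
      rw [abs_lt] at *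
      rw [abs_le] at h2 h3
      constructor <;> linarith
    refine (HasSum.tsum_eq ?_).symm
    rw [ENNReal.summable.hasSum_iff_tendsto_nat]
    simp_rw [hpart]
    exact ENNReal.tendsto_ofReal hSt
  let μ : Measure Ω := Measure.ofMeasurable (fun E _ => ENNReal.ofReal (L E))
    (by simp [hempty]) hiUnion
  have hμ : ∀ E, MeasurableSet E → μ E = ENNReal.ofReal (L E) := fun E hE =>
    Measure.ofMeasurable_apply E hE
  let Q : ProbabilityMeasure Ω := ⟨μ, ⟨by rw [hμ _ .univ, huniv, ENNReal.ofReal_one]⟩⟩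
  refine ⟨Q, ?_⟩
  refine Metric.tendsto_atTop.2 fun ε hε => ?_
  obtain ⟨N, hN⟩ := hunif (ε / 4) (by positivity)
  refine ⟨N, fun n hn => ?_⟩
  rw [Real.dist_eq, sub_zero, abs_of_nonneg (tvDist_nonneg _ _)]
  refine (tvDist_le (c := ε / 2) fun E hE => ?_).trans_lt (by linarith)
  have h1 := (abs_le.1 (hN n hn E hE)).2
  have h2 : μ.real E = L E := by
    rw [measureReal_def, hμ E hE, ENNReal.toReal_ofReal (hnonneg E hE)]
  change 2 * (_ - μ.real E) ≤ _
  rw [h2]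
  linarith

end TotalVariation

/-! ### Integrals of homogeneous functions of two densities -/

section Perspective

variable {Ω : Type*} [MeasurableSpace Ω]

/-- A measurable function of two extended nonnegative reals that is positively homogeneous at
finite arguments, as are the integrands of the divergences. -/
structure IsHomogeneous (F : ℝ≥0∞ → ℝ≥0∞ → ℝ≥0∞) : Prop where
  measurable : Measurable (Function.uncurry F)
  map_mul : ∀ ⦃c f g : ℝ≥0∞⦄, c ≠ ∞ → f ≠ ∞ → g ≠ ∞ → F (c * f) (c * g) = c * F f g

/-- The integral of `F (dW/dρ) (dQ/dρ)` with respect to `ρ = W + Q`. -/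
def homInt (F : ℝ≥0∞ → ℝ≥0∞ → ℝ≥0∞) (W Q : Measure Ω) : ℝ≥0∞ :=
  ∫⁻ y, F (W.rnDeriv (W + Q) y) (Q.rnDeriv (W + Q) y) ∂(W + Q)

/-- For homogeneous `F` the integral does not depend on the reference measure. -/
lemma homInt_withDensity {F : ℝ≥0∞ → ℝ≥0∞ → ℝ≥0∞} (hF : IsHomogeneous F) (ν : Measure Ω)
    {f g : Ω → ℝ≥0∞} (hf : Measurable f) (hg : Measurable g)
    (hf' : ∫⁻ y, f y ∂ν ≠ ∞) (hg' : ∫⁻ y, g y ∂ν ≠ ∞) :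
    homInt F (ν.withDensity f) (ν.withDensity g) = ∫⁻ y, F (f y) (g y) ∂ν := by
  have : IsFiniteMeasure (ν.withDensity f) := isFiniteMeasure_withDensity hf'
  have : IsFiniteMeasure (ν.withDensity g) := isFiniteMeasure_withDensity hg'
  set W := ν.withDensity f with hW
  set Q := ν.withDensity g with hQ
  have hρ : W + Q = ν.withDensity (f + g) := (withDensity_add_left hf g).symm
  set r := W.rnDeriv (W + Q) with hr
  set t := Q.rnDeriv (W + Q) with ht
  have hrm : Measurable r := Measure.measurable_rnDeriv _ _
  have htm : Measurable t := Measure.measurable_rnDeriv _ _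
  have key : ∀ (u k : Ω → ℝ≥0∞), Measurable u → Measurable k → ∫⁻ y, k y ∂ν ≠ ∞ →
      (W + Q).withDensity u = ν.withDensity k → k =ᵐ[ν] fun y => (f y + g y) * u y := by
    intro u k hu hk hkf h
    rw [hρ, ← withDensity_mul _ (hf.add hg) hu] at h
    exact (withDensity_eq_iff hk.aemeasurable ((hf.add hg).mul hu).aemeasurable hkf).1 h.symm
  have hfr := key r f hrm hf hf' (Measure.withDensity_rnDeriv_eq _ _
    (Measure.AbsolutelyContinuous.rfl.add_right Q))
  have hgt := key t g htm hg hg' (Measure.withDensity_rnDeriv_eq _ _ (by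
    rw [add_comm]; exact Measure.AbsolutelyContinuous.rfl.add_right W))
  have hfin : ∀ u : Ω → ℝ≥0∞, (∀ᵐ y ∂(W + Q), u y < ∞) →
      ∀ᵐ y ∂ν, f y + g y ≠ 0 → u y < ∞ := by
    intro u hu
    rw [hρ] at hu
    exact (ae_withDensity_iff (hf.add hg)).1 hu
  have hFm : Measurable fun y => F (r y) (t y) := hF.measurable.comp (hrm.prodMk htm)
  unfold homInt
  rw [← hr, ← ht, hρ, lintegral_withDensity_eq_lintegral_mul _ (hf.add hg) hFm]
  refine lintegral_congr_ae ?_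
  filter_upwards [hfr, hgt, hfin r (Measure.rnDeriv_lt_top _ _),
    hfin t (Measure.rnDeriv_lt_top _ _), ae_lt_top hf hf', ae_lt_top hg hg']
    with y h1 h2 h3 h4 h5 h6
  simp only [Pi.mul_apply, Pi.add_apply]
  by_cases h0 : f y + g y = 0
  · rw [h0, zero_mul]
    obtain ⟨h7, h8⟩ := add_eq_zero.1 h0
    have := hF.map_mul (c := 0) (f := 0) (g := 0) (by simp) (by simp) (by simp)
    rw [zero_mul, zero_mul] at this
    rw [h7, h8, this]
  · rw [← hF.map_mul (ENNReal.add_lt_top.2 ⟨h5, h6⟩).ne (h3 h0).ne (h4 h0).ne, ← h1, ← h2]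

lemma homInt_eq_lintegral_rnDeriv {F : ℝ≥0∞ → ℝ≥0∞ → ℝ≥0∞} (hF : IsHomogeneous F)
    {W Q ν : Measure Ω} [IsFiniteMeasure W] [IsFiniteMeasure Q] [SigmaFinite ν]
    (hW : W ≪ ν) (hQ : Q ≪ ν) :
    homInt F W Q = ∫⁻ y, F (W.rnDeriv ν y) (Q.rnDeriv ν y) ∂ν := by
  rw [← homInt_withDensity hF ν (Measure.measurable_rnDeriv _ _) (Measure.measurable_rnDeriv _ _)
    (Measure.lintegral_rnDeriv_lt_top _ _).ne (Measure.lintegral_rnDeriv_lt_top _ _).ne,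
    Measure.withDensity_rnDeriv_eq _ _ hW, Measure.withDensity_rnDeriv_eq _ _ hQ]

end Perspective

/-! ### Joint measures -/

section Joint

variable {Y : Type*} [MeasurableSpace Y] {𝒲 : Set (ProbabilityMeasure Y)}

lemma lintegral_priorMeasure_prod (P : Prior 𝒲) (ν : Measure Y) [SFinite ν]
    {k : Supp P × Y → ℝ≥0∞} (hk : Measurable k) :
    ∫⁻ z, k z ∂((priorMeasure P : Measure (Supp P)).prod ν)
      = ∑ w : Supp P, P.weights w.1 * ∫⁻ y, k (w, y) ∂ν := by
  rw [lintegral_prod _ hk.aemeasurable]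
  change ∫⁻ w, _ ∂(∑ w : Supp P, P.weights w.1 • Measure.dirac w) = _
  rw [lintegral_finsetSum_measure]
  refine Finset.sum_congr rfl fun w _ => ?_
  rw [lintegral_smul_measure, lintegral_dirac' _ measurable_from_top]
  rfl

lemma jointMeasure_apply (P : Prior 𝒲) {E : Set (Supp P × Y)} (hE : MeasurableSet E) :
    (jointMeasure P : Measure (Supp P × Y)) E
      = ∑ w : Supp P, P.weights w.1 * ((w.1 : ProbabilityMeasure Y) : Measure Y)
          (Prod.mk w ⁻¹' E) := by
  change ((priorMeasure P : Measure (Supp P)) ⊗ₘ channel P) E = _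
  rw [Measure.compProd_apply hE]
  change ∫⁻ w, _ ∂(∑ w : Supp P, P.weights w.1 • Measure.dirac w) = _
  rw [lintegral_finsetSum_measure]
  refine Finset.sum_congr rfl fun w _ => ?_
  rw [lintegral_smul_measure, lintegral_dirac' _ measurable_from_top]
  rfl

lemma priorMeasure_prod_apply (P : Prior 𝒲) (Q : ProbabilityMeasure Y) {E : Set (Supp P × Y)}
    (hE : MeasurableSet E) :
    ((priorMeasure P).prod Q : Measure (Supp P × Y)) E
      = ∑ w : Supp P, P.weights w.1 * (Q : Measure Y) (Prod.mk w ⁻¹' E) := by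
  change ((priorMeasure P : Measure (Supp P)).prod (Q : Measure Y)) E = _
  rw [← lintegral_indicator_one hE,
    lintegral_priorMeasure_prod P _ (measurable_one.indicator hE)]
  refine Finset.sum_congr rfl fun w _ => ?_
  rw [← lintegral_indicator_one (measurable_prodMk_left hE)]
  rfl

/-- Functionals given by homogeneous functions are affine in the prior. -/
lemma homInt_joint {F : ℝ≥0∞ → ℝ≥0∞ → ℝ≥0∞} (hF : IsHomogeneous F) (P : Prior 𝒲)
    (Q : ProbabilityMeasure Y) :
    homInt F (jointMeasure P : Measure (Supp P × Y))
        ((priorMeasure P).prod Q : Measure (Supp P × Y))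
      = ∑ w ∈ P.weights.support, (P.weights w : ℝ≥0∞)
          * homInt F ((w : ProbabilityMeasure Y) : Measure Y) Q := by
  classical
  set ν : Measure Y := mixture P + Q with hν
  have hw : ∀ w : Supp P, ((w.1 : ProbabilityMeasure Y) : Measure Y) ≪ ν := fun w =>
    (absolutelyContinuous_mixture P w.2).trans (Measure.AbsolutelyContinuous.rfl.add_right _)
  have hQ : (Q : Measure Y) ≪ ν := by
    rw [hν, add_comm]; exact Measure.AbsolutelyContinuous.rfl.add_right _
  set f : Supp P × Y → ℝ≥0∞ := fun z =>
    ((z.1.1 : ProbabilityMeasure Y) : Measure Y).rnDeriv ν z.2 with hf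
  set g : Supp P × Y → ℝ≥0∞ := fun z => (Q : Measure Y).rnDeriv ν z.2 with hg
  have hfm : Measurable f := measurable_from_prod_countable_right fun w =>
    Measure.measurable_rnDeriv ((w.1 : ProbabilityMeasure Y) : Measure Y) ν
  have hgm : Measurable g := (Measure.measurable_rnDeriv _ _).comp measurable_snd
  set π : Measure (Supp P × Y) := (priorMeasure P : Measure (Supp P)).prod ν with hπ
  have hsec : ∀ (k : Supp P × Y → ℝ≥0∞), Measurable k → ∀ E, MeasurableSet E →
      π.withDensity k E = ∑ w : Supp P, P.weights w.1 *
        (ν.withDensity fun y => k (w, y)) (Prod.mk w ⁻¹' E) := by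
    intro k hk E hE
    rw [withDensity_apply _ hE, ← lintegral_indicator hE,
      lintegral_priorMeasure_prod P _ (hk.indicator hE)]
    refine Finset.sum_congr rfl fun w _ => ?_
    rw [withDensity_apply _ (measurable_prodMk_left hE),
      ← lintegral_indicator (measurable_prodMk_left hE)]
    rfl
  have hJ : (jointMeasure P : Measure (Supp P × Y)) = π.withDensity f := by
    ext E hE
    rw [jointMeasure_apply P hE, hsec f hfm E hE]
    refine Finset.sum_congr rfl fun w _ => ?_
    simp only [hf]
    rw [Measure.withDensity_rnDeriv_eq _ _ (hw w)]
  have hR : ((priorMeasure P).prod Q : Measure (Supp P × Y)) = π.withDensity g := by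
    ext E hE
    rw [priorMeasure_prod_apply P Q hE, hsec g hgm E hE]
    refine Finset.sum_congr rfl fun w _ => ?_
    simp only [hg]
    rw [Measure.withDensity_rnDeriv_eq _ _ hQ]
  have hfin : ∀ k : Supp P × Y → ℝ≥0∞, IsProbabilityMeasure (π.withDensity k) →
      ∫⁻ z, k z ∂π ≠ ∞ := by
    intro k hk
    have := measure_univ (μ := π.withDensity k)
    rw [withDensity_apply _ .univ, Measure.restrict_univ] at this
    simp [this]
  have hFm : Measurable fun z => F (f z) (g z) := hF.measurable.comp (hfm.prodMk hgm)
  rw [hJ, hR, homInt_withDensity hF π hfm hgm (hfin f (hJ ▸ inferInstance))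
    (hfin g (hR ▸ inferInstance)),
    lintegral_priorMeasure_prod P _ hFm,
    ← Finset.sum_coe_sort P.weights.support]
  refine Finset.sum_congr rfl fun w _ => ?_
  rw [homInt_eq_lintegral_rnDeriv hF (hw w) hQ]

end Joint

/-! ### The integrand of the Hellinger divergence of finite order -/

section Integrand

/-- The convex function `(t ^ a - a t + a - 1) / (a - 1)`, with its limit `t log t + 1 - t` in order
one. It is nonnegative on `[0, ∞)` and vanishes at `1`. -/
def hellingerFun (a t : ℝ) : ℝ :=
  if a = 1 then InformationTheory.klFun t else (t ^ a - a * t + a - 1) / (a - 1)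

/-- The limit of `hellingerFun a t / t` as `t` tends to infinity. -/
def hellingerSlope (a : ℝ) : ℝ≥0∞ := if a < 1 then ENNReal.ofReal (a / (1 - a)) else ∞

/-- The perspective `g * hellingerFun a (f / g)` of the function `hellingerFun a`, extended to
`g = 0` by its limit. -/
def hellingerIntegrand (a : ℝ) (f g : ℝ≥0∞) : ℝ≥0∞ :=
  if g = 0 then f * hellingerSlope a else g * ENNReal.ofReal (hellingerFun a (f / g).toReal)

lemma hellingerFun_one_right (a : ℝ) : hellingerFun a 1 = 0 := by
  unfold hellingerFun
  split_ifs <;> simp [InformationTheory.klFun_one]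

lemma continuous_hellingerFun {a : ℝ} (ha : 0 < a) : Continuous (hellingerFun a) := by
  unfold hellingerFun
  split_ifs
  · exact InformationTheory.continuous_klFun
  · have := Real.continuous_rpow_const (q := a) ha.le
    fun_prop

lemma isHomogeneous_hellingerIntegrand {a : ℝ} (ha : 0 < a) :
    IsHomogeneous (hellingerIntegrand a) where
  measurable := by
    refine Measurable.ite (measurable_snd (measurableSet_singleton 0)) (by fun_prop) ?_
    refine measurable_snd.mul (ENNReal.measurable_ofReal.comp
      ((continuous_hellingerFun ha).measurable.comp (ENNReal.measurable_toReal.comp ?_)))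
    fun_prop
  map_mul c f g hc hf hg := by
    rcases eq_or_ne c 0 with rfl | h0
    · simp [hellingerIntegrand]
    · unfold hellingerIntegrand
      simp only [mul_eq_zero, h0, false_or]
      split_ifs
      · rw [mul_assoc]
      · rw [ENNReal.mul_div_mul_left _ _ h0 hc, mul_assoc]

lemma isHomogeneous_rpow_mul_rpow {a : ℝ} (ha : 0 < a) :
    IsHomogeneous fun f g => f ^ a * g ^ (1 - a) where
  measurable := by
    simp only [Function.uncurry_def]
    fun_prop
  map_mul c f g hc hf hg := by
    rcases eq_or_ne c 0 with rfl | h0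
    · simp [ha]
    · rw [ENNReal.mul_rpow_of_ne_top hc hf, ENNReal.mul_rpow_of_ne_top hc hg]
      have : c = c ^ a * c ^ (1 - a) := by
        rw [← ENNReal.rpow_add _ _ h0 hc]; simp
      nth_rw 3 [this]
      ring

/-- The constant in the comparison of the Hellinger integrand with that of order `1 / 2`. -/
def hellingerConst (a : ℝ) : ℝ := if a < 1 then max 1 ((1 - a) / a) else 1

lemma one_le_hellingerConst (a : ℝ) : 1 ≤ hellingerConst a := by
  unfold hellingerConst
  split_ifs <;> simp

lemma one_le_const_mul_slope {a : ℝ} (ha : 0 < a) :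
    1 ≤ ENNReal.ofReal (hellingerConst a) * hellingerSlope a := by
  have h1 := one_le_hellingerConst a
  unfold hellingerSlope
  split_ifs with h
  · rw [← ENNReal.ofReal_mul (by linarith), ENNReal.one_le_ofReal]
    have h2 : (1 - a) / a ≤ hellingerConst a := by
      rw [hellingerConst, if_pos h]; exact le_max_right _ _
    have h3 : 0 < 1 - a := by linarith
    calc (1 : ℝ) = (1 - a) / a * (a / (1 - a)) := by field_simp
      _ ≤ _ := by gcongr
  · rw [ENNReal.mul_top]
    · exact le_top
    · rw [← pos_iff_ne_zero, ENNReal.ofReal_pos]; linarith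

/-- The Hellinger integrand of every order dominates that of order `1 / 2` up to a constant, by
weighted arithmetic-geometric mean inequalities. -/
lemma sq_sqrt_sub_one_le {a : ℝ} (ha : 0 < a) {t : ℝ} (ht : 0 ≤ t) :
    (√t - 1) ^ 2 ≤ hellingerConst a * hellingerFun a t := by
  obtain ⟨s, hs, rfl⟩ : ∃ s : ℝ, 0 ≤ s ∧ t = s ^ 2 :=
    ⟨√t, Real.sqrt_nonneg _, (Real.sq_sqrt ht).symm⟩
  rw [Real.sqrt_sq hs]
  have hpow : (s ^ 2) ^ a = s ^ (2 * a) := by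
    rw [← Real.rpow_natCast, ← Real.rpow_mul hs]; norm_num
  rcases lt_trichotomy a 1 with h | rfl | h
  · have h1 : 0 < 1 - a := by linarith
    rw [hellingerConst, if_pos h, hellingerFun, if_neg h.ne, hpow]
    have hfrac : (s ^ (2 * a) - a * s ^ 2 + a - 1) / (a - 1)
        = (a * s ^ 2 + (1 - a) - s ^ (2 * a)) / (1 - a) := by
      rw [div_eq_div_iff (by linarith) (by linarith)]; ring
    rw [hfrac]
    rcases le_total a (1 / 2) with h2 | h2
    · -- `t ^ a` is the weighted geometric mean of `√t` and `1`
      have hag := Real.geom_mean_le_arith_mean2_weighted (w₁ := 2 * a) (w₂ := 1 - 2 * a)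
        (p₁ := s) (p₂ := 1) (by linarith) (by linarith) hs zero_le_one (by ring)
      rw [Real.one_rpow] at hag
      have : a * (s - 1) ^ 2 ≤ a * s ^ 2 + (1 - a) - s ^ (2 * a) := by nlinarith
      calc (s - 1) ^ 2 = (1 - a) / a * (a * (s - 1) ^ 2 / (1 - a)) := by field_simp
        _ ≤ _ := by gcongr; exact le_max_right _ _
    · -- `t ^ a` is the weighted geometric mean of `√t` and `t`
      have hag := Real.geom_mean_le_arith_mean2_weighted (w₁ := 2 * (1 - a)) (w₂ := 2 * a - 1)
        (p₁ := s) (p₂ := s ^ 2) (by linarith) (by linarith) hs (by positivity) (by ring)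
      have hs' : s ^ (2 * (1 - a)) * (s ^ 2) ^ (2 * a - 1) = s ^ (2 * a) := by
        rw [← Real.rpow_natCast, ← Real.rpow_mul hs, ← Real.rpow_add_of_nonneg hs (by linarith)
          (by push_cast; linarith)]
        congr 1; push_cast; ring
      rw [hs'] at hag
      have : (1 - a) * (s - 1) ^ 2 ≤ a * s ^ 2 + (1 - a) - s ^ (2 * a) := by nlinarith
      calc (s - 1) ^ 2 = 1 * ((1 - a) * (s - 1) ^ 2 / (1 - a)) := by field_simp
        _ ≤ _ := by
          have h3 := div_nonneg (le_trans (by positivity) this) h1.le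
          gcongr
          exact le_max_left _ _
  · rw [hellingerConst, if_neg (lt_irrefl _), hellingerFun, if_pos rfl, one_mul,
      InformationTheory.klFun_apply]
    rcases hs.eq_or_lt with rfl | hs
    · norm_num
    · rw [Real.log_pow]
      have h1 := Real.one_sub_inv_le_log_of_pos hs
      have h2 : s ^ 2 * (1 - s⁻¹) ≤ s ^ 2 * Real.log s := by gcongr
      have h3 : s ^ 2 * (1 - s⁻¹) = s ^ 2 - s := by field_simp
      push_cast
      nlinarith
  · rw [hellingerConst, if_neg h.le.not_gt, hellingerFun, if_neg h.ne', hpow, one_mul,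
      le_div_iff₀ (by linarith)]
    have h1 : 0 < 2 * a - 1 := by linarith
    -- `t` is the weighted geometric mean of `t ^ a` and `√t`
    have hag := Real.geom_mean_le_arith_mean2_weighted (w₁ := 1 / (2 * a - 1))
      (w₂ := 2 * (a - 1) / (2 * a - 1)) (p₁ := s ^ (2 * a)) (p₂ := s) (by positivity)
      (div_nonneg (by linarith) h1.le) (by positivity) hs (by field_simp; ring)
    have hs' : (s ^ (2 * a)) ^ (1 / (2 * a - 1)) * s ^ (2 * (a - 1) / (2 * a - 1)) = s ^ 2 := by
      rw [← Real.rpow_mul hs, ← Real.rpow_add_of_nonneg hs (by positivity)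
          (div_nonneg (by linarith) h1.le), ← Real.rpow_natCast]
      congr 1; push_cast; field_simp; ring
    rw [hs'] at hag
    have h2 : (2 * a - 1) * s ^ 2 ≤ s ^ (2 * a) + 2 * (a - 1) * s := by
      calc _ ≤ (2 * a - 1) * (1 / (2 * a - 1) * s ^ (2 * a) + 2 * (a - 1) / (2 * a - 1) * s) := by
            gcongr
        _ = _ := by field_simp
    nlinarith

lemma hellingerFun_nonneg {a : ℝ} (ha : 0 < a) {t : ℝ} (ht : 0 ≤ t) : 0 ≤ hellingerFun a t := by
  have h1 := sq_sqrt_sub_one_le ha ht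
  have h2 := one_le_hellingerConst a
  by_contra h
  push Not at h
  nlinarith [sq_nonneg (√t - 1)]

lemma eventually_mul_le_hellingerFun {a : ℝ} (ha : 0 < a) {r : ℝ}
    (hr : ENNReal.ofReal r < hellingerSlope a) : ∀ᶠ t in atTop, r * t ≤ hellingerFun a t := by
  rcases lt_trichotomy a 1 with h | rfl | h
  · rw [hellingerSlope, if_pos h, ENNReal.ofReal_lt_ofReal_iff'] at hr
    have h1 : 0 < 1 - a := by linarith
    have ht : Tendsto (fun t : ℝ => t ^ (a - 1)) atTop (𝓝 0) := by
      simpa using tendsto_rpow_neg_atTop h1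
    have h2 : 0 < a - r * (1 - a) := by
      have := hr.1
      rw [lt_div_iff₀ h1] at this
      linarith
    filter_upwards [ht.eventually_lt_const h2, eventually_gt_atTop 0] with t h3 h4
    have h5 : t ^ a = t ^ (a - 1) * t := by
      rw [← Real.rpow_add_one h4.ne']; simp
    rw [hellingerFun, if_neg h.ne, h5, le_div_iff_of_neg (by linarith)]
    nlinarith [mul_lt_mul_of_pos_right h3 h4]
  · filter_upwards [Real.tendsto_log_atTop.eventually_ge_atTop (r + 1), eventually_gt_atTop 0]
      with t h3 h4
    rw [hellingerFun, if_pos rfl, InformationTheory.klFun_apply]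
    nlinarith
  · have ht : Tendsto (fun t : ℝ => t ^ (a - 1)) atTop atTop := tendsto_rpow_atTop (by linarith)
    filter_upwards [ht.eventually_ge_atTop (r * (a - 1) + a), eventually_gt_atTop 0] with t h3 h4
    have h5 : t ^ a = t ^ (a - 1) * t := by
      rw [← Real.rpow_add_one h4.ne']; simp
    rw [hellingerFun, if_neg h.ne', h5, le_div_iff₀ (by linarith)]
    nlinarith

/-- The Hellinger integrand is lower semicontinuous in its second argument. -/
lemma hellingerIntegrand_le_liminf {a : ℝ} (ha : 0 < a) {f g : ℝ≥0∞} {u : ℕ → ℝ≥0∞} (hf : f ≠ ∞)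
    (hg : g ≠ ∞) (hu : Tendsto u atTop (𝓝 g)) :
    hellingerIntegrand a f g ≤ liminf (fun n => hellingerIntegrand a f (u n)) atTop := by
  rcases eq_or_ne g 0 with rfl | h0
  · rw [hellingerIntegrand, if_pos rfl]
    rcases eq_or_ne f 0 with rfl | hf0
    · simp
    refine le_of_forall_lt fun c hc => ?_
    have hc' : c / f < hellingerSlope a := by
      rwa [ENNReal.div_lt_iff (Or.inl hf0) (Or.inl hf), mul_comm]
    obtain ⟨r, hcr, hr⟩ := ENNReal.lt_iff_exists_nnreal_btwn.1 hc'
    rw [ENNReal.div_lt_iff (Or.inl hf0) (Or.inl hf)] at hcr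
    refine hcr.trans_le (le_liminf_of_le (by isBoundedDefault) ?_)
    obtain ⟨T, hT⟩ := eventually_atTop.1 (eventually_mul_le_hellingerFun ha (r := r)
      (by rwa [ENNReal.ofReal_coe_nnreal]))
    have hdiv : Tendsto (fun n => f / u n) atTop (𝓝 ∞) := by
      have := ENNReal.Tendsto.const_div (a := f) hu (Or.inr hf)
      rwa [ENNReal.div_zero hf0] at this
    filter_upwards [hdiv.eventually_const_lt (ENNReal.ofReal_lt_top (r := T)),
      hu.eventually_lt_const ENNReal.zero_lt_top] with n hn hun
    unfold hellingerIntegrand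
    split_ifs with hn0
    · rw [mul_comm]; gcongr
    · have hfin : f / u n ≠ ∞ := ENNReal.div_ne_top hf hn0
      have h1 := hT (f / u n).toReal ((ENNReal.ofReal_le_iff_le_toReal hfin).1 hn.le)
      calc (r : ℝ≥0∞) * f = u n * (r * (f / u n)) := by
            rw [mul_left_comm, ENNReal.mul_div_cancel hn0 hun.ne]
        _ = u n * ENNReal.ofReal (r * (f / u n).toReal) := by
            rw [ENNReal.ofReal_mul r.coe_nonneg, ENNReal.ofReal_coe_nnreal,
              ENNReal.ofReal_toReal hfin]
        _ ≤ _ := by gcongr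
  · have hdiv : Tendsto (fun n => f / u n) atTop (𝓝 (f / g)) :=
      ENNReal.Tendsto.const_div hu (Or.inr hf)
    have hlim : Tendsto (fun n => u n * ENNReal.ofReal (hellingerFun a (f / u n).toReal)) atTop
        (𝓝 (g * ENNReal.ofReal (hellingerFun a (f / g).toReal))) := by
      refine ENNReal.Tendsto.mul hu (Or.inl h0) (ENNReal.tendsto_ofReal ?_) (Or.inr hg)
      exact ((continuous_hellingerFun ha).tendsto _).comp
        ((ENNReal.tendsto_toReal (ENNReal.div_ne_top hf h0)).comp hdiv)
    rw [hellingerIntegrand, if_neg h0]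
    refine (hlim.congr' ?_).liminf_eq.ge
    filter_upwards [hu.eventually_ne h0] with n hn
    rw [hellingerIntegrand, if_neg hn]

lemma hellingerIntegrand_ofReal {a x y : ℝ} (hx : 0 ≤ x) (hy : 0 < y) :
    hellingerIntegrand a (ENNReal.ofReal x) (ENNReal.ofReal y)
      = ENNReal.ofReal (y * hellingerFun a (x / y)) := by
  rw [hellingerIntegrand, if_neg (by simpa using hy), ← ENNReal.ofReal_div_of_pos hy,
    ENNReal.toReal_ofReal (by positivity), ENNReal.ofReal_mul hy.le]

lemma rpow_mul_rpow_add_of_lt_one {a : ℝ} (ha : 0 < a) (h : a < 1) {f g : ℝ≥0∞} (hf : f ≠ ∞)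
    (hg : g ≠ ∞) :
    f ^ a * g ^ (1 - a) + ENNReal.ofReal (1 - a) * hellingerIntegrand a f g
      = ENNReal.ofReal a * f + ENNReal.ofReal (1 - a) * g := by
  have h1 : 0 < 1 - a := by linarith
  rcases eq_or_ne g 0 with rfl | h0
  · rw [hellingerIntegrand, if_pos rfl, hellingerSlope, if_pos h, ENNReal.zero_rpow_of_pos h1,
      mul_left_comm, ← ENNReal.ofReal_mul h1.le, mul_div_cancel₀ _ h1.ne']
    simp [mul_comm]
  · obtain ⟨x, hx, rfl⟩ : ∃ x : ℝ, 0 ≤ x ∧ f = ENNReal.ofReal x :=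
      ⟨f.toReal, ENNReal.toReal_nonneg, (ENNReal.ofReal_toReal hf).symm⟩
    obtain ⟨y, hy, rfl⟩ : ∃ y : ℝ, 0 < y ∧ g = ENNReal.ofReal y :=
      ⟨g.toReal, ENNReal.toReal_pos h0 hg, (ENNReal.ofReal_toReal hg).symm⟩
    have hn := hellingerFun_nonneg ha (t := x / y) (by positivity)
    rw [hellingerIntegrand_ofReal hx hy, ENNReal.ofReal_rpow_of_nonneg hx ha.le,
      ENNReal.ofReal_rpow_of_pos hy, ← ENNReal.ofReal_mul (by positivity),
      ← ENNReal.ofReal_mul (by positivity), ← ENNReal.ofReal_mul (by positivity),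
      ← ENNReal.ofReal_mul (by positivity), ← ENNReal.ofReal_add (by positivity) (by positivity),
      ← ENNReal.ofReal_add (by positivity) (by positivity)]
    congr 1
    rw [hellingerFun, if_neg h.ne, Real.div_rpow hx hy.le, Real.rpow_sub hy, Real.rpow_one]
    have h2 : a - 1 ≠ 0 := by linarith
    have h3 : y ^ a ≠ 0 := by positivity
    field_simp
    ring

lemma rpow_mul_rpow_add_of_one_lt {a : ℝ} (h : 1 < a) {f g : ℝ≥0∞} (hf : f ≠ ∞) (hg : g ≠ ∞) :
    f ^ a * g ^ (1 - a) + ENNReal.ofReal (a - 1) * g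
      = ENNReal.ofReal a * f + ENNReal.ofReal (a - 1) * hellingerIntegrand a f g := by
  have h1 : 0 < a - 1 := by linarith
  have ha : 0 < a := by linarith
  rcases eq_or_ne g 0 with rfl | h0
  · rw [hellingerIntegrand, if_pos rfl, hellingerSlope, if_neg h.le.not_gt,
      ENNReal.zero_rpow_of_neg (by linarith)]
    rcases eq_or_ne f 0 with rfl | hf0
    · simp [ha]
    · have hfa : f ^ a ≠ 0 := by simp [ENNReal.rpow_eq_zero_iff, hf0, hf]
      have ha1 : ENNReal.ofReal (a - 1) ≠ 0 := by simpa using h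
      rw [ENNReal.mul_top hf0, ENNReal.mul_top hfa, ENNReal.mul_top ha1]
      simp
  · obtain ⟨x, hx, rfl⟩ : ∃ x : ℝ, 0 ≤ x ∧ f = ENNReal.ofReal x :=
      ⟨f.toReal, ENNReal.toReal_nonneg, (ENNReal.ofReal_toReal hf).symm⟩
    obtain ⟨y, hy, rfl⟩ : ∃ y : ℝ, 0 < y ∧ g = ENNReal.ofReal y :=
      ⟨g.toReal, ENNReal.toReal_pos h0 hg, (ENNReal.ofReal_toReal hg).symm⟩
    have hn := hellingerFun_nonneg ha (t := x / y) (by positivity)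
    rw [hellingerIntegrand_ofReal hx hy, ENNReal.ofReal_rpow_of_nonneg hx ha.le,
      ENNReal.ofReal_rpow_of_pos hy, ← ENNReal.ofReal_mul (by positivity),
      ← ENNReal.ofReal_mul (by positivity), ← ENNReal.ofReal_mul (by positivity),
      ← ENNReal.ofReal_mul (by positivity), ← ENNReal.ofReal_add (by positivity) (by positivity),
      ← ENNReal.ofReal_add (by positivity) (by positivity)]
    congr 1
    rw [hellingerFun, if_neg h.ne', Real.div_rpow hx hy.le, Real.rpow_sub hy, Real.rpow_one]
    have h3 : y ^ a ≠ 0 := by positivity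
    field_simp
    ring

/-- The pointwise form of the Pinsker type inequality. -/
lemma le_add_hellingerIntegrand {a : ℝ} (ha : 0 < a) {ε : ℝ} (hε : 0 < ε) (hε' : ε ≤ 1 / 2)
    {f g : ℝ≥0∞} (hf : f ≠ ∞) (hg : g ≠ ∞) :
    f ≤ g + ENNReal.ofReal ε * (f + g)
      + ENNReal.ofReal (hellingerConst a / (2 * ε)) * hellingerIntegrand a f g := by
  have hK := one_le_hellingerConst a
  have hKε : hellingerConst a ≤ hellingerConst a / (2 * ε) := by
    rw [le_div_iff₀ (by positivity)]; nlinarith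
  rcases eq_or_ne g 0 with rfl | h0
  · refine le_trans ?_ le_add_self
    rw [hellingerIntegrand, if_pos rfl]
    calc f = f * 1 := (mul_one f).symm
      _ ≤ f * (ENNReal.ofReal (hellingerConst a / (2 * ε)) * hellingerSlope a) := by
          gcongr
          exact (one_le_const_mul_slope ha).trans (by gcongr)
      _ = _ := by ring
  · obtain ⟨x, hx, rfl⟩ : ∃ x : ℝ, 0 ≤ x ∧ f = ENNReal.ofReal x :=
      ⟨f.toReal, ENNReal.toReal_nonneg, (ENNReal.ofReal_toReal hf).symm⟩
    obtain ⟨y, hy, rfl⟩ : ∃ y : ℝ, 0 < y ∧ g = ENNReal.ofReal y :=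
      ⟨g.toReal, ENNReal.toReal_pos h0 hg, (ENNReal.ofReal_toReal hg).symm⟩
    have hn := hellingerFun_nonneg ha (t := x / y) (by positivity)
    have hk := sq_sqrt_sub_one_le ha (t := x / y) (by positivity)
    rw [hellingerIntegrand_ofReal hx hy, ← ENNReal.ofReal_add hx hy.le, ← ENNReal.ofReal_mul hε.le,
      ← ENNReal.ofReal_mul (by positivity), ← ENNReal.ofReal_add hy.le (by positivity),
      ← ENNReal.ofReal_add (by positivity) (by positivity)]
    refine ENNReal.ofReal_le_ofReal ?_
    obtain ⟨s, hs, hst⟩ : ∃ s : ℝ, 0 ≤ s ∧ x / y = s ^ 2 :=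
      ⟨√(x / y), Real.sqrt_nonneg _, (Real.sq_sqrt (by positivity)).symm⟩
    rw [hst] at hk ⊢
    rw [Real.sqrt_sq hs] at hk
    have hxy : x = s ^ 2 * y := by rw [← hst]; field_simp
    -- Young's inequality for `s ^ 2 - 1 = (s - 1) * (s + 1)`
    have h1 : s ^ 2 ≤ 1 + ε * (s ^ 2 + 1) + (s - 1) ^ 2 / (2 * ε) := by
      have h2 : 0 ≤ ((s - 1) - ε * (s + 1)) ^ 2 / (2 * ε) := by positivity
      have h3 : ((s - 1) - ε * (s + 1)) ^ 2 / (2 * ε)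
          = (s - 1) ^ 2 / (2 * ε) - (s ^ 2 - 1) + ε * (s + 1) ^ 2 / 2 := by
        field_simp; ring
      nlinarith [mul_nonneg hε.le (sq_nonneg (s - 1))]
    have h4 : (s - 1) ^ 2 / (2 * ε)
        ≤ hellingerConst a / (2 * ε) * hellingerFun a (s ^ 2) := by
      rw [div_mul_eq_mul_div]; gcongr
    rw [hxy]
    nlinarith

end Integrand

/-! ### Rényi divergences of finite order through Hellinger divergences -/

section Hellinger

variable {Ω : Type*} [MeasurableSpace Ω]

/-- The Hellinger divergence of finite positive order `a`: the integral of `hellingerIntegrand`. -/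
def hellingerDiv (a : ℝ) (W Q : ProbabilityMeasure Ω) : ℝ≥0∞ :=
  homInt (hellingerIntegrand a) (W : Measure Ω) Q

/-- The integral `∫ f ^ a g ^ (1 - a)` of two probability densities `f` and `g`. -/
def affinity (a : ℝ) (W Q : ProbabilityMeasure Ω) : ℝ≥0∞ :=
  homInt (fun f g => f ^ a * g ^ (1 - a)) (W : Measure Ω) Q

/-- The increasing function taking a Rényi divergence of order `a` to the Hellinger divergence. -/
def renyiToHellinger (a c : ℝ) : ℝ := if a = 1 then c else (Real.exp ((a - 1) * c) - 1) / (a - 1)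

lemma renyiToHellinger_zero (a : ℝ) : renyiToHellinger a 0 = 0 := by
  unfold renyiToHellinger
  split_ifs <;> simp

lemma continuous_renyiToHellinger (a : ℝ) : Continuous (renyiToHellinger a) := by
  unfold renyiToHellinger
  split_ifs <;> fun_prop

lemma strictMono_renyiToHellinger (a : ℝ) : StrictMono (renyiToHellinger a) := by
  intro x y hxy
  unfold renyiToHellinger
  split_ifs with h
  · exact hxy
  · rcases lt_or_gt_of_ne h with h | h
    · rw [div_lt_div_right_of_neg (by linarith), sub_lt_sub_iff_right, Real.exp_lt_exp]
      nlinarith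
    · rw [div_lt_div_iff_of_pos_right (by linarith), sub_lt_sub_iff_right, Real.exp_lt_exp]
      nlinarith

lemma renyiDiv_eq_affinity {α : ℝ≥0∞} (hα : α ≠ ∞) (hα1 : α ≠ 1) (W Q : ProbabilityMeasure Ω) :
    renyiDiv α W Q = ((1 / (α.toReal - 1) : ℝ) : EReal) * ENNReal.log (affinity α.toReal W Q) := by
  simp only [renyiDiv, if_neg hα, if_neg hα1]
  rfl

lemma lintegral_rnDeriv_add_left (W Q : ProbabilityMeasure Ω) :
    ∫⁻ y, (W : Measure Ω).rnDeriv (W + Q : Measure Ω) y ∂(W + Q : Measure Ω) = 1 := by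
  rw [Measure.lintegral_rnDeriv (Measure.AbsolutelyContinuous.rfl.add_right _), measure_univ]

lemma lintegral_rnDeriv_add_right (W Q : ProbabilityMeasure Ω) :
    ∫⁻ y, (Q : Measure Ω).rnDeriv (W + Q : Measure Ω) y ∂(W + Q : Measure Ω) = 1 := by
  rw [add_comm]
  exact lintegral_rnDeriv_add_left Q W

/-- The relation between the affinity and the Hellinger divergence; for orders above one see
`affinity_add_of_one_lt`. It is written without subtraction, the terms being possibly infinite. -/
lemma affinity_add_of_lt_one {a : ℝ} (ha : 0 < a) (h : a < 1) (W Q : ProbabilityMeasure Ω) :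
    affinity a W Q + ENNReal.ofReal (1 - a) * hellingerDiv a W Q = 1 := by
  have hφ : Measurable fun y => hellingerIntegrand a ((W : Measure Ω).rnDeriv (W + Q : Measure Ω) y)
      ((Q : Measure Ω).rnDeriv (W + Q : Measure Ω) y) :=
    (isHomogeneous_hellingerIntegrand ha).measurable.comp
      ((Measure.measurable_rnDeriv _ _).prodMk (Measure.measurable_rnDeriv _ _))
  unfold affinity hellingerDiv homInt
  rw [← lintegral_const_mul _ hφ, ← lintegral_add_right _ (hφ.const_mul _)]
  calc _ = ∫⁻ y, (ENNReal.ofReal a * (W : Measure Ω).rnDeriv (W + Q : Measure Ω) y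
          + ENNReal.ofReal (1 - a) * (Q : Measure Ω).rnDeriv (W + Q : Measure Ω) y)
          ∂(W + Q : Measure Ω) := by
        refine lintegral_congr_ae ?_
        filter_upwards [Measure.rnDeriv_ne_top (W : Measure Ω) (W + Q : Measure Ω),
          Measure.rnDeriv_ne_top (Q : Measure Ω) (W + Q : Measure Ω)] with y h1 h2
        exact rpow_mul_rpow_add_of_lt_one ha h h1 h2
    _ = 1 := by
        rw [lintegral_add_left ((Measure.measurable_rnDeriv _ _).const_mul _),
          lintegral_const_mul _ (Measure.measurable_rnDeriv _ _),
          lintegral_const_mul _ (Measure.measurable_rnDeriv _ _), lintegral_rnDeriv_add_left,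
          lintegral_rnDeriv_add_right, mul_one, mul_one,
          ← ENNReal.ofReal_add ha.le (by linarith)]
        simp

lemma affinity_add_of_one_lt {a : ℝ} (h : 1 < a) (W Q : ProbabilityMeasure Ω) :
    affinity a W Q + ENNReal.ofReal (a - 1)
      = ENNReal.ofReal a + ENNReal.ofReal (a - 1) * hellingerDiv a W Q := by
  have ha : 0 < a := by linarith
  have hφ : Measurable fun y => hellingerIntegrand a ((W : Measure Ω).rnDeriv (W + Q : Measure Ω) y)
      ((Q : Measure Ω).rnDeriv (W + Q : Measure Ω) y) :=
    (isHomogeneous_hellingerIntegrand ha).measurable.comp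
      ((Measure.measurable_rnDeriv _ _).prodMk (Measure.measurable_rnDeriv _ _))
  have h1 : ENNReal.ofReal (a - 1) = ∫⁻ y, ENNReal.ofReal (a - 1)
      * (Q : Measure Ω).rnDeriv (W + Q : Measure Ω) y ∂(W + Q : Measure Ω) := by
    rw [lintegral_const_mul _ (Measure.measurable_rnDeriv _ _), lintegral_rnDeriv_add_right,
      mul_one]
  have h2 : ENNReal.ofReal a = ∫⁻ y, ENNReal.ofReal a
      * (W : Measure Ω).rnDeriv (W + Q : Measure Ω) y ∂(W + Q : Measure Ω) := by
    rw [lintegral_const_mul _ (Measure.measurable_rnDeriv _ _), lintegral_rnDeriv_add_left,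
      mul_one]
  unfold affinity hellingerDiv homInt
  rw [← lintegral_const_mul _ hφ]
  nth_rw 1 [h1, h2]
  rw [← lintegral_add_right _ ((Measure.measurable_rnDeriv _ _).const_mul _),
    ← lintegral_add_right _ (hφ.const_mul _)]
  refine lintegral_congr_ae ?_
  filter_upwards [Measure.rnDeriv_ne_top (W : Measure Ω) (W + Q : Measure Ω),
    Measure.rnDeriv_ne_top (Q : Measure Ω) (W + Q : Measure Ω)] with y h3 h4
  exact rpow_mul_rpow_add_of_one_lt h h3 h4

/-- In order one the Hellinger divergence is the Kullback-Leibler divergence. -/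
lemma hellingerDiv_one (W Q : ProbabilityMeasure Ω) :
    hellingerDiv 1 W Q = InformationTheory.klDiv (W : Measure Ω) Q := by
  have hF := isHomogeneous_hellingerIntegrand one_pos
  by_cases hWQ : (W : Measure Ω) ≪ Q
  · rw [InformationTheory.klDiv_eq_lintegral_klFun_of_ac hWQ, hellingerDiv,
      homInt_eq_lintegral_rnDeriv hF hWQ Measure.AbsolutelyContinuous.rfl]
    refine lintegral_congr_ae ?_
    filter_upwards [Measure.rnDeriv_self (Q : Measure Ω)] with y hy
    simp [hy, hellingerIntegrand, hellingerFun]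
  · -- a finite integral forces the density of `W` to vanish where that of `Q` does
    rw [InformationTheory.klDiv_of_not_ac hWQ, hellingerDiv, homInt]
    set ρ : Measure Ω := W + Q with hρ
    set f := (W : Measure Ω).rnDeriv ρ with hf
    set g := (Q : Measure Ω).rnDeriv ρ with hg
    have hWd : ρ.withDensity f = W := Measure.withDensity_rnDeriv_eq _ _
      (Measure.AbsolutelyContinuous.rfl.add_right _)
    have hQd : ρ.withDensity g = Q := Measure.withDensity_rnDeriv_eq _ _
      (by rw [hρ, add_comm]; exact Measure.AbsolutelyContinuous.rfl.add_right _)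
    have hfm : Measurable f := Measure.measurable_rnDeriv _ _
    have hgm : Measurable g := Measure.measurable_rnDeriv _ _
    have hφ : Measurable fun y => hellingerIntegrand 1 (f y) (g y) :=
      hF.measurable.comp (hfm.prodMk hgm)
    by_contra hne
    refine hWQ (Measure.AbsolutelyContinuous.mk fun E hE hQE => ?_)
    rw [← hQd, withDensity_apply _ hE, lintegral_eq_zero_iff hgm] at hQE
    rw [← hWd, withDensity_apply _ hE, lintegral_eq_zero_iff hfm]
    filter_upwards [hQE, ae_restrict_of_ae (ae_lt_top hφ hne)] with y h1 h2
    by_contra h3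
    simp only [Pi.zero_apply] at h1 h3
    rw [hellingerIntegrand, if_pos h1, hellingerSlope, if_neg (lt_irrefl _),
      ENNReal.mul_top h3] at h2
    exact lt_irrefl _ h2

/-- Upper bounds on the Rényi divergence of finite order are upper bounds on the Hellinger
divergence. -/
lemma renyiDiv_le_coe_iff {α : ℝ≥0∞} (hα : 0 < α) (hα' : α ≠ ∞) (W Q : ProbabilityMeasure Ω)
    {c : ℝ} (hc : 0 ≤ c) :
    renyiDiv α W Q ≤ (c : EReal) ↔
      hellingerDiv α.toReal W Q ≤ ENNReal.ofReal (renyiToHellinger α.toReal c) := by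
  rcases eq_or_ne α 1 with rfl | hα1
  · rw [ENNReal.toReal_one, hellingerDiv_one, renyiToHellinger, if_pos rfl]
    simp only [renyiDiv, if_neg ENNReal.one_ne_top, if_true]
    rw [← EReal.coe_ennreal_le_coe_ennreal_iff, EReal.coe_ennreal_ofReal, max_eq_left hc]
  rw [renyiDiv_eq_affinity hα' hα1]
  have ha : 0 < α.toReal := ENNReal.toReal_pos hα.ne' hα'
  have ha1 : α.toReal ≠ 1 := by
    rwa [Ne, ENNReal.toReal_eq_one_iff]
  have hΦ : 0 ≤ renyiToHellinger α.toReal c := by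
    rw [← renyiToHellinger_zero α.toReal]
    exact (strictMono_renyiToHellinger _).monotone hc
  generalize α.toReal = a at *
  rcases lt_or_gt_of_ne ha1 with h | h
  · have h1 : 0 < 1 - a := by linarith
    have key := affinity_add_of_lt_one ha h W Q
    generalize affinity a W Q = A at *
    generalize hellingerDiv a W Q = H at *
    have hA : A ≠ ∞ := fun hA => by simp [hA] at key
    have hH : H ≠ ∞ := fun hH => by
      rw [hH, ENNReal.mul_top (by simpa using h)] at key; simp at key
    have key' : A.toReal + (1 - a) * H.toReal = 1 := by
      have := congrArg ENNReal.toReal key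
      rwa [ENNReal.toReal_add hA (ENNReal.mul_ne_top ENNReal.ofReal_ne_top hH),
        ENNReal.toReal_mul, ENNReal.toReal_ofReal h1.le, ENNReal.toReal_one] at this
    rw [← ENNReal.ofReal_toReal hH, ENNReal.ofReal_le_ofReal_iff hΦ, renyiToHellinger, if_neg ha1,
      le_div_iff_of_neg (by linarith)]
    rcases eq_or_ne A 0 with rfl | hA0
    · rw [ENNReal.log_zero,
        EReal.coe_mul_bot_of_neg (by rw [one_div]; exact inv_lt_zero.2 (by linarith))]
      simp only [top_le_iff, EReal.coe_ne_top, false_iff, not_le]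
      rw [ENNReal.toReal_zero] at key'
      nlinarith [Real.exp_pos ((a - 1) * c)]
    · have hApos := ENNReal.toReal_pos hA0 hA
      rw [ENNReal.log_pos_real hA0 hA, ← EReal.coe_mul, EReal.coe_le_coe_iff, one_div,
        ← div_eq_inv_mul, div_le_iff_of_neg (by linarith), mul_comm c, Real.le_log_iff_exp_le hApos]
      constructor <;> intro h2 <;> nlinarith
  · have h1 : 0 < a - 1 := by linarith
    have key := affinity_add_of_one_lt h W Q
    generalize affinity a W Q = A at *
    generalize hellingerDiv a W Q = H at *
    rcases eq_or_ne H ∞ with rfl | hH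
    · rw [ENNReal.mul_top (by simpa using h)] at key
      have hA : A = ∞ := by
        by_contra hA
        exact (ENNReal.add_lt_top.2 ⟨lt_top_iff_ne_top.2 hA, ENNReal.ofReal_lt_top⟩).ne
          (key.trans (by simp))
      rw [hA, ENNReal.log_top, EReal.coe_mul_top_of_pos (by positivity)]
      simp
    · have hA : A ≠ ∞ := fun hA => by
        rw [hA, top_add] at key
        exact (ENNReal.add_lt_top.2 ⟨ENNReal.ofReal_lt_top,
          ENNReal.mul_lt_top ENNReal.ofReal_lt_top (lt_top_iff_ne_top.2 hH)⟩).ne key.symm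
      have key' : A.toReal + (a - 1) = a + (a - 1) * H.toReal := by
        have := congrArg ENNReal.toReal key
        rwa [ENNReal.toReal_add hA ENNReal.ofReal_ne_top,
          ENNReal.toReal_add ENNReal.ofReal_ne_top (ENNReal.mul_ne_top ENNReal.ofReal_ne_top hH),
          ENNReal.toReal_mul, ENNReal.toReal_ofReal h1.le, ENNReal.toReal_ofReal ha.le] at this
      have hApos : 0 < A.toReal := by nlinarith [ENNReal.toReal_nonneg (a := H)]
      have hA0 : A ≠ 0 := fun h0 => by simp [h0] at hApos
      rw [← ENNReal.ofReal_toReal hH, ENNReal.ofReal_le_ofReal_iff hΦ, renyiToHellinger,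
        if_neg ha1, le_div_iff₀ h1, ENNReal.log_pos_real hA0 hA, ← EReal.coe_mul,
        EReal.coe_le_coe_iff, one_div, inv_mul_le_iff₀ h1, Real.log_le_iff_le_exp hApos]
      constructor <;> intro h2 <;> nlinarith

/-- Upper bounds on the Rényi divergence of infinite order are dominations of measures. -/
lemma renyiDiv_top_le_coe_iff (W Q : ProbabilityMeasure Ω) (c : ℝ) :
    renyiDiv ∞ W Q ≤ (c : EReal) ↔
      (W : Measure Ω) ≤ ENNReal.ofReal (Real.exp c) • (Q : Measure Ω) := by
  set k := ENNReal.ofReal (Real.exp c) with hk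
  have hk0 : k ≠ 0 := by simp [hk, Real.exp_pos]
  have hkt : k ≠ ∞ := ENNReal.ofReal_ne_top
  have hlog : (c : EReal) = ENNReal.log k := by
    rw [hk, ENNReal.log_ofReal_of_pos (Real.exp_pos c), Real.log_exp]
  simp only [renyiDiv, if_true]
  rw [hlog, ENNReal.log_le_log_iff]
  set ρ : Measure Ω := W + Q with hρ
  set f := (W : Measure Ω).rnDeriv ρ with hf
  set g := (Q : Measure Ω).rnDeriv ρ with hg
  have hWd : ρ.withDensity f = W := Measure.withDensity_rnDeriv_eq _ _
    (Measure.AbsolutelyContinuous.rfl.add_right _)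
  have hQd : ρ.withDensity g = Q := Measure.withDensity_rnDeriv_eq _ _
    (by rw [hρ, add_comm]; exact Measure.AbsolutelyContinuous.rfl.add_right _)
  have hfm : Measurable f := Measure.measurable_rnDeriv _ _
  have hgm : Measurable g := Measure.measurable_rnDeriv _ _
  have hess : essSup (fun y => f y / g y) ρ ≤ k ↔ ∀ᵐ y ∂ρ, f y ≤ k * g y := by
    have : (∀ᵐ y ∂ρ, f y ≤ k * g y) ↔ ∀ᵐ y ∂ρ, f y / g y ≤ k :=
      eventually_congr (Eventually.of_forall fun y =>
        (ENNReal.div_le_iff_le_mul (Or.inr hkt) (Or.inr hk0)).symm)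
    rw [this]
    exact ⟨fun h => (ENNReal.ae_le_essSup _).mono fun y hy => hy.trans h,
      fun h => essSup_le_of_ae_le _ h⟩
  rw [hess, ← hWd, ← hQd, ← withDensity_smul _ hgm]
  constructor
  · exact fun h => withDensity_mono h
  · intro h
    refine ae_le_of_forall_setLIntegral_le_of_sigmaFinite hfm fun E hE _ => ?_
    have := h E
    rwa [withDensity_apply _ hE, withDensity_apply _ hE] at this

end Hellinger

/-! ### Positivity, Pinsker inequality and lower semicontinuity -/

section Properties

variable {Ω : Type*} [MeasurableSpace Ω] {α : ℝ≥0∞}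

lemma one_le_of_le_smul {W Q : ProbabilityMeasure Ω} {k : ℝ≥0∞}
    (h : (W : Measure Ω) ≤ k • (Q : Measure Ω)) : 1 ≤ k := by
  simpa using h Set.univ

lemma renyiDiv_nonneg (hα : 0 < α) (W Q : ProbabilityMeasure Ω) : 0 ≤ renyiDiv α W Q := by
  rcases eq_or_ne α ∞ with rfl | hα'
  · by_contra! h
    obtain ⟨c, hc1, hc2⟩ := EReal.lt_iff_exists_real_btwn.1 h
    have h1 := one_le_of_le_smul ((renyiDiv_top_le_coe_iff W Q c).1 hc1.le)
    rw [ENNReal.one_le_ofReal, Real.one_le_exp_iff] at h1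
    exact absurd hc2 (not_lt.2 (by exact_mod_cast h1))
  rcases eq_or_ne α 1 with rfl | hα1
  · simp only [renyiDiv, if_neg ENNReal.one_ne_top, if_true]
    exact EReal.coe_ennreal_nonneg _
  rw [renyiDiv_eq_affinity hα' hα1, EReal.mul_nonneg_iff]
  have ha : 0 < α.toReal := ENNReal.toReal_pos hα.ne' hα'
  have ha1 : α.toReal ≠ 1 := by
    rwa [Ne, ENNReal.toReal_eq_one_iff]
  rcases lt_or_gt_of_ne ha1 with h | h
  · refine Or.inr ⟨?_, ?_⟩
    · norm_cast
      rw [one_div, inv_nonpos]; linarith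
    · rw [ENNReal.log_le_zero_iff, ← affinity_add_of_lt_one ha h W Q]
      exact le_self_add
  · refine Or.inl ⟨?_, ?_⟩
    · norm_cast
      rw [one_div, inv_nonneg]; linarith
    · rw [ENNReal.zero_le_log_iff]
      have h1 := affinity_add_of_one_lt h W Q
      have h2 : ENNReal.ofReal α.toReal = 1 + ENNReal.ofReal (α.toReal - 1) := by
        rw [← ENNReal.ofReal_one, ← ENNReal.ofReal_add zero_le_one (by linarith)]
        congr 1; ring
      rw [h2] at h1
      refine (ENNReal.add_le_add_iff_right (ENNReal.ofReal_ne_top (r := α.toReal - 1))).1 ?_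
      rw [h1]
      exact le_self_add

lemma renyiDiv_self (hα : 0 < α) (W : ProbabilityMeasure Ω) : renyiDiv α W W = 0 := by
  refine le_antisymm ?_ (renyiDiv_nonneg hα W W)
  rcases eq_or_ne α ∞ with rfl | hα'
  · refine (renyiDiv_top_le_coe_iff W W 0).2 ?_
    simp
  · refine (renyiDiv_le_coe_iff hα hα' W W le_rfl).2 ?_
    have ha : 0 < α.toReal := ENNReal.toReal_pos hα.ne' hα'
    rw [hellingerDiv, homInt_eq_lintegral_rnDeriv (isHomogeneous_hellingerIntegrand ha)
      Measure.AbsolutelyContinuous.rfl Measure.AbsolutelyContinuous.rfl,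
      renyiToHellinger_zero, ENNReal.ofReal_zero, nonpos_iff_eq_zero,
      lintegral_eq_zero_iff' ?_]
    · filter_upwards [Measure.rnDeriv_self (W : Measure Ω)] with y hy
      simp [hy, hellingerIntegrand, hellingerFun_one_right]
    · exact ((isHomogeneous_hellingerIntegrand ha).measurable.comp
        ((Measure.measurable_rnDeriv _ _).prodMk (Measure.measurable_rnDeriv _ _))).aemeasurable

/-- A small Hellinger divergence bounds differences of probabilities, after optimizing over `ε`. -/
lemma real_sub_le_hellingerDiv {a : ℝ} (ha : 0 < a) {ε : ℝ} (hε : 0 < ε) (hε' : ε ≤ 1 / 2)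
    (W Q : ProbabilityMeasure Ω) {B : ℝ} (hB : 0 ≤ B)
    (h : hellingerDiv a W Q ≤ ENNReal.ofReal B) {E : Set Ω} (hE : MeasurableSet E) :
    (W : Measure Ω).real E - (Q : Measure Ω).real E ≤ 2 * ε + hellingerConst a / (2 * ε) * B := by
  have hK := one_le_hellingerConst a
  set ρ : Measure Ω := W + Q with hρ
  set f := (W : Measure Ω).rnDeriv ρ with hf
  set g := (Q : Measure Ω).rnDeriv ρ with hg
  have hWd : ρ.withDensity f = W := Measure.withDensity_rnDeriv_eq _ _
    (Measure.AbsolutelyContinuous.rfl.add_right _)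
  have hQd : ρ.withDensity g = Q := Measure.withDensity_rnDeriv_eq _ _
    (by rw [hρ, add_comm]; exact Measure.AbsolutelyContinuous.rfl.add_right _)
  have hfm : Measurable f := Measure.measurable_rnDeriv _ _
  have hgm : Measurable g := Measure.measurable_rnDeriv _ _
  have hφ : Measurable fun y => hellingerIntegrand a (f y) (g y) :=
    (isHomogeneous_hellingerIntegrand ha).measurable.comp (hfm.prodMk hgm)
  have key : (W : Measure Ω) E ≤ (Q : Measure Ω) E + ENNReal.ofReal ε * (1 + 1)
      + ENNReal.ofReal (hellingerConst a / (2 * ε)) * ENNReal.ofReal B := by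
    calc (W : Measure Ω) E = ∫⁻ y in E, f y ∂ρ := by rw [← withDensity_apply _ hE, hWd]
      _ ≤ ∫⁻ y in E, (g y + ENNReal.ofReal ε * (f y + g y)
          + ENNReal.ofReal (hellingerConst a / (2 * ε)) * hellingerIntegrand a (f y) (g y)) ∂ρ := by
          refine lintegral_mono_ae (ae_restrict_of_ae ?_)
          filter_upwards [Measure.rnDeriv_ne_top (W : Measure Ω) ρ,
            Measure.rnDeriv_ne_top (Q : Measure Ω) ρ] with y h1 h2
          exact le_add_hellingerIntegrand ha hε hε' h1 h2
      _ = ∫⁻ y in E, g y ∂ρ + ENNReal.ofReal ε * (∫⁻ y in E, f y ∂ρ + ∫⁻ y in E, g y ∂ρ)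
          + ENNReal.ofReal (hellingerConst a / (2 * ε))
            * ∫⁻ y in E, hellingerIntegrand a (f y) (g y) ∂ρ := by
          rw [lintegral_add_right _ (hφ.const_mul _), lintegral_add_left hgm,
            lintegral_const_mul _ (show Measurable fun y => f y + g y from hfm.add hgm),
            lintegral_add_left hfm,
            lintegral_const_mul _ hφ]
      _ ≤ _ := by
          have h1 : ∫⁻ y in E, hellingerIntegrand a (f y) (g y) ∂ρ ≤ ENNReal.ofReal B :=
            (setLIntegral_le_lintegral _ _).trans h
          rw [← withDensity_apply _ hE, ← withDensity_apply _ hE, hWd, hQd]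
          gcongr
          · exact prob_le_one
          · exact prob_le_one
  have key2 := ENNReal.toReal_mono (by finiteness) key
  rw [ENNReal.toReal_add (by finiteness) (by finiteness),
    ENNReal.toReal_add (by finiteness) (by finiteness), ENNReal.toReal_mul, ENNReal.toReal_mul,
    ENNReal.toReal_ofReal hε.le, ENNReal.toReal_ofReal hB,
    ENNReal.toReal_ofReal (by positivity)] at key2
  have h2 : (1 + 1 : ℝ≥0∞).toReal = 2 := by norm_num
  rw [h2] at key2
  simp only [measureReal_def]
  linarith

/-- A Pinsker type inequality: measures at small Rényi divergence are close in total variation. -/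
lemma exists_tvDist_le_of_renyiDiv_le (hα : 0 < α) {ε : ℝ} (hε : 0 < ε) :
    ∃ δ : ℝ, 0 < δ ∧ ∀ W Q : ProbabilityMeasure Ω,
      renyiDiv α W Q ≤ (δ : EReal) → tvDist W Q ≤ ε := by
  rcases eq_or_ne α ∞ with rfl | hα'
  · refine ⟨Real.log (1 + ε / 2), Real.log_pos (by linarith), fun W Q h => tvDist_le fun E hE => ?_⟩
    rw [renyiDiv_top_le_coe_iff, Real.exp_log (by positivity)] at h
    have h1 := ENNReal.toReal_mono (by simp; finiteness) (h E)
    rw [Measure.smul_apply, smul_eq_mul, ENNReal.toReal_mul,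
      ENNReal.toReal_ofReal (by positivity)] at h1
    have h2 := measureReal_le_one (μ := (Q : Measure Ω)) (s := E)
    simp only [measureReal_def] at h2 ⊢
    nlinarith
  · have ha : 0 < α.toReal := ENNReal.toReal_pos hα.ne' hα'
    generalize hβ : α.toReal = a at ha
    have hK := one_le_hellingerConst a
    obtain ⟨η, hη, hη1, hη2⟩ : ∃ η : ℝ, 0 < η ∧ η ≤ 1 / 2 ∧ η ≤ ε / 8 :=
      ⟨min (1 / 2) (ε / 8), by positivity, min_le_left _ _, min_le_right _ _⟩
    obtain ⟨B, hB, hB'⟩ : ∃ B : ℝ, 0 < B ∧ hellingerConst a / (2 * η) * B ≤ ε / 4 :=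
      ⟨ε / 4 / (hellingerConst a / (2 * η)), by positivity, by
        rw [mul_div_cancel₀]; positivity⟩
    have hlim : ∀ᶠ c in 𝓝 (0 : ℝ), renyiToHellinger a c < B :=
      (continuous_renyiToHellinger a).tendsto 0 |>.eventually_lt_const
        (by rwa [renyiToHellinger_zero])
    obtain ⟨δ, hδ, hδB⟩ := (Metric.eventually_nhds_iff.1 hlim)
    have hδ2 := hδB (y := δ / 2) (by
      rw [Real.dist_eq, sub_zero, abs_of_pos (by positivity)]; linarith)
    refine ⟨δ / 2, by positivity, fun W Q h => tvDist_le fun E hE => ?_⟩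
    rw [renyiDiv_le_coe_iff hα hα' W Q (by positivity), hβ] at h
    have := real_sub_le_hellingerDiv ha hη hη1 W Q hB.le
      (h.trans (ENNReal.ofReal_le_ofReal hδ2.le)) hE
    linarith

/-- The `L¹` distance of densities is at most the total variation distance. -/
lemma integral_abs_toReal_rnDeriv_sub_le (W Q : ProbabilityMeasure Ω) (ν : Measure Ω)
    [SigmaFinite ν] (hW : (W : Measure Ω) ≪ ν) (hQ : (Q : Measure Ω) ≪ ν) :
    ∫ y, |((W : Measure Ω).rnDeriv ν y).toReal - ((Q : Measure Ω).rnDeriv ν y).toReal| ∂ν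
      ≤ tvDist W Q := by
  set u := fun y => ((W : Measure Ω).rnDeriv ν y).toReal with hu
  set v := fun y => ((Q : Measure Ω).rnDeriv ν y).toReal with hv
  have hui : Integrable u ν := Measure.integrable_toReal_rnDeriv
  have hvi : Integrable v ν := Measure.integrable_toReal_rnDeriv
  have hum : Measurable u := (Measure.measurable_rnDeriv _ _).ennreal_toReal
  have hvm : Measurable v := (Measure.measurable_rnDeriv _ _).ennreal_toReal
  have hE : MeasurableSet {y | v y ≤ u y} := measurableSet_le hvm hum
  have hi : Integrable (fun y => |u y - v y|) ν := (hui.sub hvi).abs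
  change ∫ y, |u y - v y| ∂ν ≤ _
  rw [← integral_add_compl hE hi]
  have h1 : ∫ y in {y | v y ≤ u y}, |u y - v y| ∂ν
      = (W : Measure Ω).real {y | v y ≤ u y} - (Q : Measure Ω).real {y | v y ≤ u y} := by
    rw [← Measure.setIntegral_toReal_rnDeriv hW, ← Measure.setIntegral_toReal_rnDeriv hQ,
      ← integral_sub hui.integrableOn hvi.integrableOn]
    refine setIntegral_congr_fun hE fun y hy => ?_
    exact abs_of_nonneg (sub_nonneg.2 hy)
  have h2 : ∫ y in {y | v y ≤ u y}ᶜ, |u y - v y| ∂ν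
      = (Q : Measure Ω).real {y | v y ≤ u y}ᶜ - (W : Measure Ω).real {y | v y ≤ u y}ᶜ := by
    rw [← Measure.setIntegral_toReal_rnDeriv hW, ← Measure.setIntegral_toReal_rnDeriv hQ,
      ← integral_sub hvi.integrableOn hui.integrableOn]
    refine setIntegral_congr_fun hE.compl fun y hy => ?_
    have hy' : u y < v y := not_le.1 hy
    change |u y - v y| = v y - u y
    rw [abs_sub_comm]
    exact abs_of_nonneg (sub_nonneg.2 hy'.le)
  have h3 := le_tvDist W Q hE
  rw [h1, h2, probReal_compl_eq_one_sub hE, probReal_compl_eq_one_sub hE]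
  linarith

/-- Lower semicontinuity in the second argument: convergence in total variation gives almost
everywhere convergence of densities along a subsequence, to which Fatou's lemma applies. -/
lemma hellingerDiv_le_of_tendsto {a : ℝ} (ha : 0 < a) {q : ℕ → ProbabilityMeasure Ω}
    {W Q : ProbabilityMeasure Ω} (h : Tendsto (fun n => tvDist (q n) Q) atTop (𝓝 0)) {B : ℝ≥0∞}
    (hB : ∀ n, hellingerDiv a W (q n) ≤ B) : hellingerDiv a W Q ≤ B := by
  -- a common dominating measure
  set π : Measure Ω :=
    (W : Measure Ω) + (Q : Measure Ω) + Measure.sum (fun n => (q n : Measure Ω)) with hπ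
  set ν : Measure Ω := π.toFinite with hν
  have hac : π ≪ ν := absolutelyContinuous_toFinite _
  have hle : (W : Measure Ω) + (Q : Measure Ω) ≤ π := Measure.le_add_right le_rfl
  have hW : (W : Measure Ω) ≪ ν := (Measure.absolutelyContinuous_of_le
    ((Measure.le_add_right le_rfl).trans hle)).trans hac
  have hQ : (Q : Measure Ω) ≪ ν := (Measure.absolutelyContinuous_of_le
    ((Measure.le_add_left le_rfl).trans hle)).trans hac
  have hq : ∀ n, (q n : Measure Ω) ≪ ν := fun n => (Measure.absolutelyContinuous_of_le
    ((Measure.le_sum _ n).trans (Measure.le_add_left le_rfl))).trans hac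
  set v : ℕ → Ω → ℝ := fun n y => ((q n : Measure Ω).rnDeriv ν y).toReal with hv
  set u : Ω → ℝ := fun y => ((Q : Measure Ω).rnDeriv ν y).toReal with hu
  have hvi : ∀ n, Integrable (v n) ν := fun n => Measure.integrable_toReal_rnDeriv
  have hui : Integrable u ν := Measure.integrable_toReal_rnDeriv
  have hL1 : Tendsto (fun n => eLpNorm (v n - u) 1 ν) atTop (𝓝 0) := by
    have hb : Tendsto (fun n => ENNReal.ofReal (tvDist (q n) Q)) atTop (𝓝 0) := by
      simpa using ENNReal.tendsto_ofReal h
    refine tendsto_of_tendsto_of_tendsto_of_le_of_le tendsto_const_nhds hb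
      (fun _ => zero_le) fun n => ?_
    dsimp only
    rw [eLpNorm_one_eq_lintegral_enorm, ← ofReal_integral_norm_eq_lintegral_enorm
      ((hvi n).sub hui)]
    exact ENNReal.ofReal_le_ofReal (integral_abs_toReal_rnDeriv_sub_le (q n) Q ν (hq n) hQ)
  obtain ⟨ns, -, hns⟩ := (tendstoInMeasure_of_tendsto_eLpNorm one_ne_zero
    (fun n => (hvi n).aestronglyMeasurable) hui.aestronglyMeasurable hL1).exists_seq_tendsto_ae
  have hF := isHomogeneous_hellingerIntegrand ha
  rw [hellingerDiv, homInt_eq_lintegral_rnDeriv hF hW hQ]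
  calc _ ≤ ∫⁻ y, liminf (fun i => hellingerIntegrand a ((W : Measure Ω).rnDeriv ν y)
        ((q (ns i) : Measure Ω).rnDeriv ν y)) atTop ∂ν := by
        refine lintegral_mono_ae ?_
        filter_upwards [hns, Measure.rnDeriv_ne_top (W : Measure Ω) ν,
          Measure.rnDeriv_ne_top (Q : Measure Ω) ν,
          ae_all_iff.2 fun n => Measure.rnDeriv_ne_top (q n : Measure Ω) ν] with y h1 h2 h3 h4
        refine hellingerIntegrand_le_liminf ha h2 h3 ?_
        exact (ENNReal.tendsto_toReal_iff (fun i => h4 (ns i)) h3).1 h1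
    _ ≤ liminf (fun i => ∫⁻ y, hellingerIntegrand a ((W : Measure Ω).rnDeriv ν y)
        ((q (ns i) : Measure Ω).rnDeriv ν y) ∂ν) atTop :=
        lintegral_liminf_le fun i => hF.measurable.comp
          ((Measure.measurable_rnDeriv _ _).prodMk (Measure.measurable_rnDeriv _ _))
    _ ≤ B := by
        refine liminf_le_of_le (by isBoundedDefault) fun b hb => ?_
        obtain ⟨i, hi⟩ := hb.exists
        refine hi.trans ?_
        rw [← homInt_eq_lintegral_rnDeriv hF hW (hq (ns i))]
        exact hB _

lemma renyiDiv_le_of_tendsto (hα : 0 < α) {q : ℕ → ProbabilityMeasure Ω}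
    {W Q : ProbabilityMeasure Ω} (h : Tendsto (fun n => tvDist (q n) Q) atTop (𝓝 0)) {c : ℝ}
    (hc : ∀ n, renyiDiv α W (q n) ≤ (c : EReal)) : renyiDiv α W Q ≤ (c : EReal) := by
  have hc0 : 0 ≤ c := by exact_mod_cast (renyiDiv_nonneg hα W (q 0)).trans (hc 0)
  rcases eq_or_ne α ∞ with rfl | hα'
  · simp only [renyiDiv_top_le_coe_iff] at hc ⊢
    refine Measure.le_iff.2 fun E hE => ?_
    have hlim : Tendsto (fun n => (q n : Measure Ω) E) atTop (𝓝 ((Q : Measure Ω) E)) := by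
      rw [← ENNReal.tendsto_toReal_iff (fun n => measure_ne_top _ _) (measure_ne_top _ _),
        tendsto_iff_dist_tendsto_zero]
      exact squeeze_zero (fun _ => dist_nonneg) (fun n => abs_real_sub_le_tvDist (q n) Q hE) h
    rw [Measure.smul_apply, smul_eq_mul]
    refine ge_of_tendsto' (ENNReal.Tendsto.const_mul hlim (Or.inr ENNReal.ofReal_ne_top))
      fun n => ?_
    exact hc n E
  · simp only [renyiDiv_le_coe_iff hα hα' _ _ hc0] at hc ⊢
    exact hellingerDiv_le_of_tendsto (ENNReal.toReal_pos hα.ne' hα') h hc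

end Properties

/-! ### The divergence of joint measures -/

section JointDivergence

variable {Y : Type*} [MeasurableSpace Y] {𝒲 : Set (ProbabilityMeasure Y)} {α : ℝ≥0∞}

/-- The mean over the prior of the Hellinger divergences from `Q`. -/
def meanHellinger (a : ℝ) (P : Prior 𝒲) (Q : ProbabilityMeasure Y) : ℝ≥0∞ :=
  ∑ w ∈ P.weights.support, (P.weights w : ℝ≥0∞) * hellingerDiv a (w : ProbabilityMeasure Y) Q

/-- The Hellinger divergence is affine in the prior, unlike the Rényi divergence. -/
lemma hellingerDiv_joint {a : ℝ} (ha : 0 < a) (P : Prior 𝒲) (Q : ProbabilityMeasure Y) :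
    hellingerDiv a (jointMeasure P) ((priorMeasure P).prod Q) = meanHellinger a P Q :=
  homInt_joint (isHomogeneous_hellingerIntegrand ha) P Q

lemma affinity_joint {a : ℝ} (ha : 0 < a) (P : Prior 𝒲) (Q : ProbabilityMeasure Y) :
    affinity a (jointMeasure P) ((priorMeasure P).prod Q)
      = ∑ w ∈ P.weights.support, (P.weights w : ℝ≥0∞)
          * affinity a (w : ProbabilityMeasure Y) Q :=
  homInt_joint (isHomogeneous_rpow_mul_rpow ha) P Q

lemma jointDiv_le_coe_iff (hα : 0 < α) (hα' : α ≠ ∞) (P : Prior 𝒲) (Q : ProbabilityMeasure Y)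
    {c : ℝ} (hc : 0 ≤ c) :
    jointDiv α P Q ≤ (c : EReal) ↔
      meanHellinger α.toReal P Q ≤ ENNReal.ofReal (renyiToHellinger α.toReal c) := by
  rw [jointDiv, renyiDiv_le_coe_iff hα hα' _ _ hc,
    hellingerDiv_joint (ENNReal.toReal_pos hα.ne' hα')]

lemma jointDiv_top_le_coe_iff (P : Prior 𝒲) (Q : ProbabilityMeasure Y) (c : ℝ) :
    jointDiv ∞ P Q ≤ (c : EReal) ↔ ∀ w ∈ P.weights.support,
      ((w : ProbabilityMeasure Y) : Measure Y)
        ≤ ENNReal.ofReal (Real.exp c) • (Q : Measure Y) := by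
  classical
  rw [jointDiv, renyiDiv_top_le_coe_iff]
  set k := ENNReal.ofReal (Real.exp c)
  constructor
  · intro h w hw
    refine Measure.le_iff.2 fun F hF => ?_
    have hp : (P.weights w : ℝ≥0∞) ≠ 0 := by simpa using hw
    let w' : Supp P := ⟨w, hw⟩
    have hE : MeasurableSet (({w'} : Set (Supp P)) ×ˢ F) :=
      MeasurableSet.prod (show MeasurableSet ({w'} : Set (Supp P)) from trivial) hF
    have h1 := h (({w'} : Set (Supp P)) ×ˢ F)
    have hpre : ∀ v : Supp P, v ≠ w' → Prod.mk v ⁻¹' (({w'} : Set (Supp P)) ×ˢ F) = ∅ := by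
      intro v hv
      ext y
      simp [hv]
    have hpre' : Prod.mk w' ⁻¹' (({w'} : Set (Supp P)) ×ˢ F) = F := by
      ext y
      simp
    rw [Measure.smul_apply, smul_eq_mul, jointMeasure_apply P hE, priorMeasure_prod_apply P Q hE,
      Finset.sum_eq_single w' (fun v _ hv => by rw [hpre v hv]; simp) (by simp),
      Finset.sum_eq_single w' (fun v _ hv => by rw [hpre v hv]; simp) (by simp), hpre',
      mul_left_comm] at h1
    rw [Measure.smul_apply, smul_eq_mul]
    exact (ENNReal.mul_le_mul_iff_right hp ENNReal.coe_ne_top).1 h1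
  · intro h
    refine Measure.le_iff.2 fun E hE => ?_
    rw [Measure.smul_apply, smul_eq_mul, jointMeasure_apply P hE, priorMeasure_prod_apply P Q hE,
      Finset.mul_sum]
    refine Finset.sum_le_sum fun w _ => ?_
    rw [mul_left_comm]
    gcongr
    exact h w.1 w.2 _

lemma jointDiv_nonneg (hα : 0 < α) (P : Prior 𝒲) (Q : ProbabilityMeasure Y) :
    0 ≤ jointDiv α P Q :=
  renyiDiv_nonneg hα _ _

/-- The joint divergence is at most the largest divergence. -/
lemma jointDiv_le_coe (hα : 0 < α) (P : Prior 𝒲) {Q : ProbabilityMeasure Y} {c : ℝ}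
    (h : ∀ W ∈ 𝒲, renyiDiv α W Q ≤ (c : EReal)) : jointDiv α P Q ≤ (c : EReal) := by
  rcases eq_or_ne α ∞ with rfl | hα'
  · rw [jointDiv_top_le_coe_iff]
    exact fun w _ => (renyiDiv_top_le_coe_iff _ _ _).1 (h w w.2)
  · obtain ⟨w, -⟩ := P.support_weights_nonempty
    have hc : 0 ≤ c := by exact_mod_cast (renyiDiv_nonneg hα _ _).trans (h w w.2)
    rw [jointDiv_le_coe_iff hα hα' P Q hc, meanHellinger]
    calc _ ≤ ∑ w ∈ P.weights.support, (P.weights w : ℝ≥0∞)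
          * ENNReal.ofReal (renyiToHellinger α.toReal c) := by
          gcongr with w hw
          exact (renyiDiv_le_coe_iff hα hα' _ _ hc).1 (h w w.2)
      _ = _ := by rw [← Finset.sum_mul, sum_weights, one_mul]

lemma renyiDiv_le_jointDiv_single (hα : 0 < α) (w : 𝒲) (Q : ProbabilityMeasure Y) :
    renyiDiv α (w : ProbabilityMeasure Y) Q
      ≤ jointDiv α (Convexity.StdSimplex.single w : Prior 𝒲) Q := by
  refine EReal.le_of_forall_lt_iff_le.1 fun c hc => ?_
  have hc0 : 0 ≤ c := by exact_mod_cast (jointDiv_nonneg hα _ _).trans hc.le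
  have hsupp : (Convexity.StdSimplex.single w : Prior 𝒲).weights.support = {w} := by
    rw [Convexity.StdSimplex.support_weights_eq_singleton]
  rcases eq_or_ne α ∞ with rfl | hα'
  · rw [renyiDiv_top_le_coe_iff]
    exact (jointDiv_top_le_coe_iff _ _ _).1 hc.le w (by rw [hsupp]; simp)
  · rw [renyiDiv_le_coe_iff hα hα' _ _ hc0]
    have := (jointDiv_le_coe_iff hα hα' _ _ hc0).1 hc.le
    rw [meanHellinger, hsupp, Finset.sum_singleton] at this
    simpa using this

lemma meanHellinger_convexCombPair (a : ℝ) {s t : ℝ≥0} (hst : s + t = 1) (P₁ P₂ : Prior 𝒲)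
    (Q : ProbabilityMeasure Y) :
    meanHellinger a (Convexity.convexCombPair s t zero_le zero_le hst P₁ P₂ : Prior 𝒲) Q
      = s * meanHellinger a P₁ Q + t * meanHellinger a P₂ Q := by
  classical
  have key : ∀ P : Prior 𝒲, meanHellinger a P Q
      = P.weights.sum fun w p => (p : ℝ≥0∞) * hellingerDiv a (w : ProbabilityMeasure Y) Q :=
    fun _ => rfl
  rw [key, key, key, Convexity.StdSimplex.weights_convexCombPair,
    Finsupp.sum_add_index' (by simp) (by intros; simp [add_mul]),
    Finsupp.sum_smul_index' (by simp), Finsupp.sum_smul_index' (by simp), Finsupp.mul_sum,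
    Finsupp.mul_sum]
  simp [mul_assoc]

/-- If a suitable mixture of two priors has joint divergence at most `C` from the product measure
and the first prior has joint divergence almost `C`, then both joint divergences are at most
slightly larger than `C`. The weight of the second prior and the tolerance `δ` depend only on `C`
and the slack `η`: in finite order the Hellinger divergence is affine in the prior, so a weight that
is small against the slack suffices; in infinite order the divergence is a maximum over the
support. -/
lemma exists_mix_prior (hα : 0 < α) (𝒲 : Set (ProbabilityMeasure Y)) {C η : ℝ} (hC : 0 ≤ C)
    (hη : 0 < η) :
    ∃ δ : ℝ, 0 < δ ∧ ∃ mix : Prior 𝒲 → Prior 𝒲 → Prior 𝒲, ∀ P₁ P₂ Q,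
      jointDiv α (mix P₁ P₂) Q ≤ (C : EReal) → ((C - δ : ℝ) : EReal) < jointDiv α P₁ Q →
        jointDiv α P₁ Q ≤ ((C + η : ℝ) : EReal) ∧ jointDiv α P₂ Q ≤ ((C + η : ℝ) : EReal) := by
  classical
  rcases eq_or_ne α ∞ with rfl | hα'
  · refine ⟨1, one_pos, fun P₁ P₂ => Convexity.convexCombPair (1 / 2 : ℝ≥0) (1 / 2 : ℝ≥0) zero_le
      zero_le (add_halves 1) P₁ P₂, fun P₁ P₂ Q h _ => ?_⟩
    have hCη : (C : EReal) ≤ ((C + η : ℝ) : EReal) := by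
      exact_mod_cast (by linarith : C ≤ C + η)
    rw [jointDiv_top_le_coe_iff] at h
    constructor <;> refine le_trans ((jointDiv_top_le_coe_iff _ _ _).2 fun w hw => h w ?_) hCη <;>
    · rw [Convexity.StdSimplex.weights_convexCombPair]
      simp only [Finsupp.mem_support_iff, Finsupp.coe_add, Finsupp.coe_smul, Pi.add_apply,
        Pi.smul_apply, smul_eq_mul] at hw ⊢
      have := pos_iff_ne_zero.2 hw
      positivity
  · generalize ha : α.toReal = a
    have hmono := strictMono_renyiToHellinger a
    have hx : 0 ≤ renyiToHellinger a C := by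
      rw [← renyiToHellinger_zero a]; exact hmono.monotone hC
    have hxy : renyiToHellinger a C < renyiToHellinger a (C + η) := hmono (by linarith)
    generalize hxdef : renyiToHellinger a C = x at hx hxy
    generalize hydef : renyiToHellinger a (C + η) = y at hxy
    have hy : 0 < y := hx.trans_lt hxy
    -- the weight `t` satisfies `x / (1 - t) < y`, which bounds the first divergence whatever the
    -- second one is
    set t : ℝ := (y - x) / (2 * y) with ht
    have hty : t * y = (y - x) / 2 := by rw [ht]; field_simp
    have ht0 : 0 < t := by rw [ht]; apply div_pos <;> linarith
    have ht1 : t < 1 := by nlinarith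
    have hs : x ≤ (1 - t) * y := by nlinarith
    -- the bound `(x - (1 - t) z) / t < y` for the second divergence holds for `z` near `x`
    have hlim : ∀ᶠ c in 𝓝 C, x - t * y < (1 - t) * renyiToHellinger a c := by
      refine (((continuous_renyiToHellinger a).tendsto C).const_mul (1 - t)).eventually_const_lt ?_
      rw [hxdef]; nlinarith
    obtain ⟨δ, hδ, hδ'⟩ := Metric.eventually_nhds_iff.1 hlim
    have hz := hδ' (y := C - δ / 2) (by
      rw [Real.dist_eq, sub_sub_cancel_left, abs_neg, abs_of_pos (by positivity)]; linarith)
    refine ⟨δ / 2, by positivity, fun P₁ P₂ => Convexity.convexCombPair (1 - t).toNNReal t.toNNReal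
      zero_le zero_le (by
        rw [← Real.toNNReal_add (by linarith) ht0.le]; simp) P₁ P₂, fun P₁ P₂ Q h h1 => ?_⟩
    have hlow : ENNReal.ofReal (renyiToHellinger a (C - δ / 2)) ≤ meanHellinger a P₁ Q := by
      rcases le_total (C - δ / 2) 0 with h0 | h0
      · rw [ENNReal.ofReal_of_nonpos]
        · exact zero_le
        · rw [← renyiToHellinger_zero a]; exact hmono.monotone h0
      · by_contra! hlt
        exact absurd h1 (not_lt.2 ((jointDiv_le_coe_iff hα hα' _ _ h0).2 (ha ▸ hlt.le)))
    rw [jointDiv_le_coe_iff hα hα' _ _ hC, ha, hxdef, meanHellinger_convexCombPair] at h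
    rw [jointDiv_le_coe_iff hα hα' _ _ (by linarith), jointDiv_le_coe_iff hα hα' _ _ (by linarith),
      ha, hydef]
    change ENNReal.ofReal (1 - t) * _ + ENNReal.ofReal t * _ ≤ _ at h
    generalize meanHellinger a P₁ Q = H₁ at *
    generalize meanHellinger a P₂ Q = H₂ at *
    have hH₁ : H₁ ≠ ∞ := fun hH => by
      rw [hH, ENNReal.mul_top (by simpa using ht1)] at h; simp at h
    have hH₂ : H₂ ≠ ∞ := fun hH => by
      rw [hH, ENNReal.mul_top (by simpa using ht0)] at h; simp at h
    have h' := ENNReal.toReal_mono ENNReal.ofReal_ne_top h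
    rw [ENNReal.toReal_add (by finiteness) (by finiteness), ENNReal.toReal_mul,
      ENNReal.toReal_mul, ENNReal.toReal_ofReal (by linarith), ENNReal.toReal_ofReal ht0.le,
      ENNReal.toReal_ofReal hx] at h'
    have hlow' := (ENNReal.ofReal_le_iff_le_toReal hH₁).1 hlow
    rw [ENNReal.le_ofReal_iff_toReal_le hH₁ hy.le, ENNReal.le_ofReal_iff_toReal_le hH₂ hy.le]
    have hn := ENNReal.toReal_nonneg (a := H₂)
    constructor
    · have : (1 - t) * H₁.toReal ≤ (1 - t) * y := by nlinarith
      exact le_of_mul_le_mul_left this (by linarith)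
    · have : (1 - t) * renyiToHellinger a (C - δ / 2) ≤ (1 - t) * H₁.toReal :=
        mul_le_mul_of_nonneg_left hlow' (by linarith)
      have : t * H₂.toReal ≤ t * y := by linarith
      exact le_of_mul_le_mul_left this ht0

end JointDivergence

/-! ### The Sibson identity -/

section Sibson

variable {Y : Type*} [MeasurableSpace Y] {𝒲 : Set (ProbabilityMeasure Y)} {α : ℝ≥0∞}

lemma coe_renyiMean (α : ℝ≥0∞) (P : Prior 𝒲) :
    (renyiMean α P : Measure Y) = (meanMeasure α P Set.univ)⁻¹ • meanMeasure α P :=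
  rfl

lemma lintegral_ne_top_of_withDensity_eq {ν μ : Measure Y} [IsFiniteMeasure μ] {f : Y → ℝ≥0∞}
    (h : ν.withDensity f = μ) : ∫⁻ y, f y ∂ν ≠ ∞ := by
  have := measure_ne_top μ Set.univ
  rwa [← h, withDensity_apply _ .univ, Measure.restrict_univ] at this

lemma mixture_absolutelyContinuous_add (P : Prior 𝒲) (Q : ProbabilityMeasure Y) :
    mixture P ≪ mixture P + (Q : Measure Y) :=
  Measure.AbsolutelyContinuous.rfl.add_right _

lemma absolutelyContinuous_mixture_add (P : Prior 𝒲) (Q : ProbabilityMeasure Y) :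
    (Q : Measure Y) ≪ mixture P + (Q : Measure Y) := by
  rw [add_comm]
  exact Measure.AbsolutelyContinuous.rfl.add_right _

/-- A change of reference measure in a density with respect to the mixture. -/
lemma withDensity_mul_eq (P : Prior 𝒲) (Q : ProbabilityMeasure Y) {k : Y → ℝ≥0∞}
    (hk : Measurable k) :
    (mixture P + (Q : Measure Y)).withDensity
      (fun y => (mixture P).rnDeriv (mixture P + (Q : Measure Y)) y * k y)
      = (mixture P).withDensity k := by
  change Measure.withDensity _ ((mixture P).rnDeriv _ * k) = _
  rw [withDensity_mul _ (Measure.measurable_rnDeriv _ _) hk,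
    Measure.withDensity_rnDeriv_eq _ _ (mixture_absolutelyContinuous_add P Q)]

lemma withDensity_density (P : Prior 𝒲) {w : 𝒲} (hw : w ∈ P.weights.support) :
    (mixture P).withDensity (density P w) = ((w : ProbabilityMeasure Y) : Measure Y) :=
  Measure.withDensity_rnDeriv_eq _ _ (absolutelyContinuous_mixture P hw)

lemma meanDensity_rpow {a : ℝ} (hα' : α ≠ ∞) (ha : 0 < α.toReal) (haα : α.toReal = a)
    (P : Prior 𝒲) (y : Y) :
    meanDensity α P y ^ a
      = ∑ w ∈ P.weights.support, (P.weights w : ℝ≥0∞) * density P w y ^ a := by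
  subst haα
  rw [meanDensity, if_neg hα', ← ENNReal.rpow_mul, one_div_mul_cancel ha.ne', ENNReal.rpow_one]

/-- The Sibson identity before taking logarithms. -/
lemma affinity_joint_eq (hα : 0 < α) (hα' : α ≠ ∞) (P : Prior 𝒲) (Q : ProbabilityMeasure Y) :
    affinity α.toReal (jointMeasure P) ((priorMeasure P).prod Q)
      = meanMeasure α P Set.univ ^ α.toReal * affinity α.toReal (renyiMean α P) Q := by
  have ha : 0 < α.toReal := ENNReal.toReal_pos hα.ne' hα'
  generalize haα : α.toReal = a at ha
  have hF := isHomogeneous_rpow_mul_rpow ha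
  set Z := meanMeasure α P Set.univ with hZ
  have hZ0 : Z ≠ 0 := meanMeasure_univ_ne_zero α P
  have hZt : Z ≠ ∞ := meanMeasure_univ_ne_top α P
  set ν : Measure Y := mixture P + (Q : Measure Y) with hν
  set m := (mixture P).rnDeriv ν with hm
  set g := (Q : Measure Y).rnDeriv ν with hg
  have hmm : Measurable m := Measure.measurable_rnDeriv _ _
  have hgm : Measurable g := Measure.measurable_rnDeriv _ _
  have hQ : ν.withDensity g = Q :=
    Measure.withDensity_rnDeriv_eq _ _ (absolutelyContinuous_mixture_add P Q)
  have hw : ∀ w ∈ P.weights.support, ν.withDensity (fun y => m y * density P w y)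
      = ((w : ProbabilityMeasure Y) : Measure Y) := fun w hw => by
    rw [withDensity_mul_eq P Q (measurable_density P w), withDensity_density P hw]
  have hMm := measurable_meanDensity α P
  have hq : ν.withDensity (fun y => Z⁻¹ * (m y * meanDensity α P y)) = renyiMean α P := by
    change ν.withDensity (Z⁻¹ • fun y => m y * meanDensity α P y) = _
    have hmM : Measurable fun y => m y * meanDensity α P y := hmm.mul hMm
    rw [withDensity_smul _ hmM, withDensity_mul_eq P Q hMm, coe_renyiMean]
    rfl
  have hint : ∀ (W : ProbabilityMeasure Y) (f : Y → ℝ≥0∞), Measurable f →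
      ν.withDensity f = W → affinity a W Q = ∫⁻ y, f y ^ a * g y ^ (1 - a) ∂ν := by
    intro W f hf h
    rw [affinity, ← h, ← hQ, homInt_withDensity hF ν hf hgm
      (lintegral_ne_top_of_withDensity_eq h) (lintegral_ne_top_of_withDensity_eq hQ)]
  rw [affinity_joint ha, hint _ _ ((hmm.mul hMm).const_mul _) hq]
  have hmeas : ∀ f : Y → ℝ≥0∞, Measurable f → Measurable fun y => f y ^ a * g y ^ (1 - a) :=
    fun f hf => hF.measurable.comp (hf.prodMk hgm)
  calc _ = ∑ w ∈ P.weights.support, ∫⁻ y, (P.weights w : ℝ≥0∞)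
          * ((m y * density P w y) ^ a * g y ^ (1 - a)) ∂ν := by
        refine Finset.sum_congr rfl fun w hws => ?_
        have hfm : Measurable fun y => m y * density P w y := hmm.mul (measurable_density P w)
        rw [hint _ _ hfm (hw w hws), lintegral_const_mul _ (hmeas _ hfm)]
    _ = ∫⁻ y, ∑ w ∈ P.weights.support, (P.weights w : ℝ≥0∞)
          * ((m y * density P w y) ^ a * g y ^ (1 - a)) ∂ν := by
        rw [lintegral_finsetSum]
        exact fun w _ => (hmeas _ (hmm.mul (measurable_density P w))).const_mul _
    _ = ∫⁻ y, Z ^ a * ((Z⁻¹ * (m y * meanDensity α P y)) ^ a * g y ^ (1 - a)) ∂ν := by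
        refine lintegral_congr fun y => ?_
        have hZZ : Z ^ a * Z⁻¹ ^ a = 1 := by
          rw [← ENNReal.mul_rpow_of_nonneg _ _ ha.le, ENNReal.mul_inv_cancel hZ0 hZt,
            ENNReal.one_rpow]
        rw [ENNReal.mul_rpow_of_nonneg _ _ ha.le, ENNReal.mul_rpow_of_nonneg _ _ ha.le,
          meanDensity_rpow hα' (haα ▸ ha) haα, ← mul_assoc, ← mul_assoc, hZZ, one_mul,
          Finset.mul_sum, Finset.sum_mul]
        refine Finset.sum_congr rfl fun w _ => ?_
        rw [ENNReal.mul_rpow_of_nonneg _ _ ha.le]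
        ring
    _ = _ := lintegral_const_mul _ (hmeas _ ((hmm.mul hMm).const_mul _))

lemma ereal_mul_add {c : ℝ} (hc : c ≠ 0) (x : ℝ) (y : EReal) :
    (c : EReal) * ((x : EReal) + y) = ((c * x : ℝ) : EReal) + (c : EReal) * y := by
  induction y with
  | bot =>
    rcases lt_or_gt_of_ne hc with h | h
    · rw [EReal.add_bot, EReal.coe_mul_bot_of_neg h, EReal.coe_add_top]
    · rw [EReal.add_bot, EReal.coe_mul_bot_of_pos h, EReal.add_bot]
  | coe y => norm_cast; ring
  | top =>
    rcases lt_or_gt_of_ne hc with h | h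
    · rw [EReal.coe_add_top, EReal.coe_mul_top_of_neg h, EReal.add_bot]
    · rw [EReal.coe_add_top, EReal.coe_mul_top_of_pos h, EReal.coe_add_top]

lemma jointDiv_eq_add_of_ne_one (hα : 0 < α) (hα' : α ≠ ∞) (hα1 : α ≠ 1) (P : Prior 𝒲)
    (Q : ProbabilityMeasure Y) :
    jointDiv α P Q = renyiInfo α P + renyiDiv α (renyiMean α P) Q := by
  have ha1 : α.toReal - 1 ≠ 0 := by
    rw [sub_ne_zero, Ne, ENNReal.toReal_eq_one_iff]
    exact hα1
  rw [jointDiv, renyiDiv_eq_affinity hα' hα1, renyiDiv_eq_affinity hα' hα1,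
    affinity_joint_eq hα hα', ENNReal.log_mul_add, ENNReal.log_rpow, renyiInfo, if_neg hα',
    if_neg hα1, ENNReal.log_pos_real (meanMeasure_univ_ne_zero α P) (meanMeasure_univ_ne_top α P),
    ← EReal.coe_mul, ereal_mul_add (one_div_ne_zero ha1), ← EReal.coe_mul,
    ← mul_assoc, one_div_mul_eq_div]

lemma withDensity_le_iff {ν : Measure Y} [SigmaFinite ν] {f g : Y → ℝ≥0∞} (hf : Measurable f) :
    ν.withDensity f ≤ ν.withDensity g ↔ f ≤ᵐ[ν] g := by
  refine ⟨fun h => ae_le_of_forall_setLIntegral_le_of_sigmaFinite hf fun E hE _ => ?_,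
    withDensity_mono⟩
  have := h E
  rwa [withDensity_apply _ hE, withDensity_apply _ hE] at this

/-- The mean measure of infinite order is the least upper bound of the measures in the support. -/
lemma meanMeasure_top_le_smul_iff (P : Prior 𝒲) (Q : ProbabilityMeasure Y) {k : ℝ≥0∞} :
    meanMeasure ∞ P ≤ k • (Q : Measure Y) ↔ ∀ w ∈ P.weights.support,
      ((w : ProbabilityMeasure Y) : Measure Y) ≤ k • (Q : Measure Y) := by
  have hsup : meanDensity ∞ P = fun y => ⨆ w ∈ P.weights.support, density P w y := by
    ext y; simp [meanDensity]
  have hMm := measurable_meanDensity ∞ P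
  constructor
  · intro h w hw
    refine le_trans ?_ h
    rw [← withDensity_density P hw, meanMeasure]
    refine withDensity_mono (Eventually.of_forall fun y => ?_)
    rw [hsup]
    exact le_iSup₂ (f := fun w (_ : w ∈ P.weights.support) => density P w y) w hw
  · intro h
    have hQ := Measure.withDensity_rnDeriv_eq _ _ (absolutelyContinuous_mixture_add P Q)
    have hmm := Measure.measurable_rnDeriv (mixture P) (mixture P + (Q : Measure Y))
    have hgm := Measure.measurable_rnDeriv (Q : Measure Y) (mixture P + (Q : Measure Y))
    have hmul := fun {k : Y → ℝ≥0∞} (hk : Measurable k) => withDensity_mul_eq P Q hk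
    have hν : IsFiniteMeasure (mixture P + (Q : Measure Y)) := inferInstance
    generalize (mixture P).rnDeriv (mixture P + (Q : Measure Y)) = m at *
    generalize (Q : Measure Y).rnDeriv (mixture P + (Q : Measure Y)) = g at *
    generalize mixture P + (Q : Measure Y) = ν at *
    have hle : ∀ k' : Y → ℝ≥0∞, Measurable k' →
        ((mixture P).withDensity k' ≤ k • (Q : Measure Y) ↔
          (fun y => m y * k' y) ≤ᵐ[ν] k • g) := by
      intro k' hk'
      rw [← hmul hk', ← hQ, ← withDensity_smul _ hgm]
      exact withDensity_le_iff (hmm.mul hk')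
    rw [meanMeasure, hle _ hMm]
    have h' : ∀ᵐ y ∂ν, ∀ w ∈ P.weights.support, m y * density P w y ≤ (k • g) y := by
      refine (Filter.eventually_all_finset _).2 fun w hw => ?_
      have h1 := h w hw
      rw [← withDensity_density P hw, hle _ (measurable_density P w)] at h1
      exact h1
    filter_upwards [h'] with y hy
    rw [hsup]
    simp only [ENNReal.mul_iSup]
    exact iSup₂_le hy

lemma ereal_eq_of_forall_le_coe_iff {x y : EReal} (h : ∀ c : ℝ, x ≤ (c : EReal) ↔ y ≤ (c : EReal)) :
    x = y :=
  le_antisymm (EReal.le_of_forall_lt_iff_le.1 fun c hc => (h c).2 hc.le)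
    (EReal.le_of_forall_lt_iff_le.1 fun c hc => (h c).1 hc.le)

lemma jointDiv_top_eq_add (P : Prior 𝒲) (Q : ProbabilityMeasure Y) :
    jointDiv ∞ P Q = renyiInfo ∞ P + renyiDiv ∞ (renyiMean ∞ P) Q := by
  set Z := meanMeasure ∞ P Set.univ with hZ
  have hZ0 : Z ≠ 0 := meanMeasure_univ_ne_zero ∞ P
  have hZt : Z ≠ ∞ := meanMeasure_univ_ne_top ∞ P
  have hZpos : 0 < Z.toReal := ENNReal.toReal_pos hZ0 hZt
  have hI : renyiInfo ∞ P = (Real.log Z.toReal : EReal) := by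
    rw [renyiInfo, if_pos rfl, ENNReal.log_pos_real hZ0 hZt]
  refine ereal_eq_of_forall_le_coe_iff fun c => ?_
  have hexp : ENNReal.ofReal (Real.exp (c - Real.log Z.toReal))
      = Z⁻¹ * ENNReal.ofReal (Real.exp c) := by
    rw [Real.exp_sub, Real.exp_log hZpos, ENNReal.ofReal_div_of_pos hZpos,
      ENNReal.ofReal_toReal hZt, ENNReal.div_eq_inv_mul]
  have hadd : renyiInfo ∞ P + renyiDiv ∞ (renyiMean ∞ P) Q ≤ (c : EReal) ↔
      renyiDiv ∞ (renyiMean ∞ P) Q ≤ ((c - Real.log Z.toReal : ℝ) : EReal) := by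
    rw [hI, EReal.coe_sub, EReal.le_sub_iff_add_le (by simp) (by simp), add_comm]
  rw [hadd, jointDiv_top_le_coe_iff, renyiDiv_top_le_coe_iff, ← meanMeasure_top_le_smul_iff,
    coe_renyiMean, hexp, mul_smul]
  constructor
  · intro h
    gcongr
  · intro h
    refine Measure.le_iff.2 fun E hE => ?_
    have h1 := h E
    simp only [Measure.smul_apply, smul_eq_mul] at h1 ⊢
    exact (ENNReal.mul_le_mul_iff_right (ENNReal.inv_ne_zero.2 hZt) (ENNReal.inv_ne_top.2 hZ0)).1 h1

lemma coe_renyiMean_one (P : Prior 𝒲) : (renyiMean 1 P : Measure Y) = mixture P := by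
  have h1 : mixture P Set.univ = 1 := by
    rw [mixture, Measure.finsetSum_apply, ← sum_weights P]
    refine Finset.sum_congr rfl fun w _ => ?_
    rw [Measure.smul_apply, measure_univ, ENNReal.smul_def, smul_eq_mul, mul_one]
  rw [coe_renyiMean, meanMeasure_one, h1, inv_one, one_smul]

lemma mul_hellingerFun_one {x y : ℝ} (hy : 0 < y) :
    y * hellingerFun 1 (x / y) = x * Real.log (x / y) + y - x := by
  rw [hellingerFun, if_pos rfl, InformationTheory.klFun_apply]
  field_simp

/-- The compensation identity for the integrand of the Kullback-Leibler divergence. -/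
lemma sum_mul_hellingerIntegrand_one {ι : Type*} (s : Finset ι) {p f : ι → ℝ≥0∞} {g : ℝ≥0∞}
    (hp : ∑ i ∈ s, p i = 1) (hf : ∀ i ∈ s, f i ≠ ∞) (hg : g ≠ ∞) :
    ∑ i ∈ s, p i * hellingerIntegrand 1 (f i) g
      = hellingerIntegrand 1 (∑ i ∈ s, p i * f i) g
        + ∑ i ∈ s, p i * hellingerIntegrand 1 (f i) (∑ i ∈ s, p i * f i) := by
  have hpt : ∀ i ∈ s, p i ≠ ∞ := fun i hi =>
    ((Finset.single_le_sum (fun _ _ => zero_le) hi).trans_lt (hp ▸ ENNReal.one_lt_top)).ne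
  have hFt : ∑ i ∈ s, p i * f i ≠ ∞ :=
    ENNReal.sum_ne_top.2 fun i hi => ENNReal.mul_ne_top (hpt i hi) (hf i hi)
  have hslope : hellingerSlope 1 = ∞ := by simp [hellingerSlope]
  rcases eq_or_ne (∑ i ∈ s, p i * f i) 0 with hF | hF
  · have hz : ∀ i ∈ s, p i = 0 ∨ f i = 0 := fun i hi => by
      simpa using (Finset.sum_eq_zero_iff.1 hF) i hi
    have h1 : ∀ u, ∑ i ∈ s, p i * hellingerIntegrand 1 (f i) u = hellingerIntegrand 1 0 u := by
      intro u
      calc _ = ∑ i ∈ s, p i * hellingerIntegrand 1 0 u := by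
            refine Finset.sum_congr rfl fun i hi => ?_
            rcases hz i hi with h | h <;> simp [h]
        _ = _ := by rw [← Finset.sum_mul, hp, one_mul]
    rw [hF, h1, h1]
    simp [hellingerIntegrand]
  rcases eq_or_ne g 0 with rfl | hg0
  · obtain ⟨i, hi, hpi⟩ := Finset.exists_ne_zero_of_sum_ne_zero hF
    have h1 : hellingerIntegrand 1 (∑ i ∈ s, p i * f i) 0 = ∞ := by
      rw [hellingerIntegrand, if_pos rfl, hslope, ENNReal.mul_top hF]
    rw [h1, top_add, ENNReal.sum_eq_top]
    refine ⟨i, hi, ?_⟩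
    rw [hellingerIntegrand, if_pos rfl, hslope, ENNReal.mul_top (right_ne_zero_of_mul hpi),
      ENNReal.mul_top (left_ne_zero_of_mul hpi)]
  set X := (∑ i ∈ s, p i * f i).toReal with hX
  have hXpos : 0 < X := ENNReal.toReal_pos hF hFt
  have hypos : 0 < g.toReal := ENNReal.toReal_pos hg0 hg
  have hXsum : ∑ i ∈ s, (p i).toReal * (f i).toReal = X := by
    rw [hX, ENNReal.toReal_sum fun i hi => ENNReal.mul_ne_top (hpt i hi) (hf i hi)]
    simp
  have hpsum : ∑ i ∈ s, (p i).toReal = 1 := by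
    rw [← ENNReal.toReal_sum hpt, hp, ENNReal.toReal_one]
  have hconv : ∀ u : ℝ, 0 < u → ∑ i ∈ s, p i * hellingerIntegrand 1 (f i) (ENNReal.ofReal u)
      = ENNReal.ofReal (∑ i ∈ s, (p i).toReal
        * (u * hellingerFun 1 ((f i).toReal / u))) := by
    intro u hu
    have hn : ∀ i, 0 ≤ hellingerFun 1 ((f i).toReal / u) := fun i =>
      hellingerFun_nonneg one_pos (by positivity)
    rw [ENNReal.ofReal_sum_of_nonneg fun i _ =>
      mul_nonneg ENNReal.toReal_nonneg (mul_nonneg hu.le (hn i))]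
    refine Finset.sum_congr rfl fun i hi => ?_
    rw [ENNReal.ofReal_mul ENNReal.toReal_nonneg, ENNReal.ofReal_toReal (hpt i hi),
      ← hellingerIntegrand_ofReal ENNReal.toReal_nonneg hu, ENNReal.ofReal_toReal (hf i hi)]
  rw [← ENNReal.ofReal_toReal hg, ← ENNReal.ofReal_toReal hFt, ← hX, hconv _ hypos, hconv _ hXpos,
    hellingerIntegrand_ofReal hXpos.le hypos, ← ENNReal.ofReal_add]
  · congr 1
    simp only [mul_hellingerFun_one hypos, mul_hellingerFun_one hXpos]
    have hterm : ∀ i ∈ s, (p i).toReal * ((f i).toReal * Real.log ((f i).toReal / g.toReal)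
          + g.toReal - (f i).toReal)
        = (p i).toReal * ((f i).toReal * Real.log ((f i).toReal / X) + X - (f i).toReal)
          + ((p i).toReal * (f i).toReal * Real.log (X / g.toReal)
          + (p i).toReal * (g.toReal - X)) := by
      intro i _
      rcases eq_or_ne (f i).toReal 0 with h0 | h0
      · rw [h0]; ring
      · rw [Real.log_div h0 hypos.ne', Real.log_div h0 hXpos.ne', Real.log_div hXpos.ne' hypos.ne']
        ring
    rw [Finset.sum_congr rfl hterm, Finset.sum_add_distrib, Finset.sum_add_distrib,
      ← Finset.sum_mul, ← Finset.sum_mul, hXsum, hpsum]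
    ring
  · exact mul_nonneg hypos.le (hellingerFun_nonneg one_pos (by positivity))
  · exact Finset.sum_nonneg fun i _ => mul_nonneg ENNReal.toReal_nonneg
      (mul_nonneg hXpos.le (hellingerFun_nonneg one_pos (by positivity)))

/-- The compensation identity for the Kullback-Leibler divergence. -/
lemma meanHellinger_one_eq_add (P : Prior 𝒲) (Q : ProbabilityMeasure Y) :
    meanHellinger 1 P Q
      = hellingerDiv 1 (renyiMean 1 P) Q + meanHellinger 1 P (renyiMean 1 P) := by
  have hF := isHomogeneous_hellingerIntegrand one_pos
  set ν : Measure Y := mixture P + (Q : Measure Y) with hν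
  set g := (Q : Measure Y).rnDeriv ν with hg
  have hgm : Measurable g := Measure.measurable_rnDeriv _ _
  set f : 𝒲 → Y → ℝ≥0∞ := fun w => ((w : ProbabilityMeasure Y) : Measure Y).rnDeriv ν with hf
  have hfm : ∀ w, Measurable (f w) := fun w => Measure.measurable_rnDeriv _ _
  have hQ : ν.withDensity g = Q :=
    Measure.withDensity_rnDeriv_eq _ _ (absolutelyContinuous_mixture_add P Q)
  have hw : ∀ w ∈ P.weights.support, ν.withDensity (f w)
      = ((w : ProbabilityMeasure Y) : Measure Y) := fun w hw =>
    Measure.withDensity_rnDeriv_eq _ _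
      ((absolutelyContinuous_mixture P hw).trans (mixture_absolutelyContinuous_add P Q))
  set S : Y → ℝ≥0∞ := fun y => ∑ w ∈ P.weights.support, (P.weights w : ℝ≥0∞) * f w y with hS
  have hSm : Measurable S := Finset.measurable_fun_sum _ fun w _ => (hfm w).const_mul _
  have hmix : ν.withDensity S = renyiMean 1 P := by
    rw [coe_renyiMean_one]
    ext E hE
    rw [withDensity_apply _ hE, hS, lintegral_finsetSum _ fun w _ => (hfm w).const_mul _,
      mixture, Measure.finsetSum_apply]
    refine Finset.sum_congr rfl fun w hws => ?_
    rw [lintegral_const_mul _ (hfm w), ← withDensity_apply _ hE, hw w hws]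
    rfl
  have hint : ∀ (W R : ProbabilityMeasure Y) (u v : Y → ℝ≥0∞), Measurable u → Measurable v →
      ν.withDensity u = W → ν.withDensity v = R →
      hellingerDiv 1 W R = ∫⁻ y, hellingerIntegrand 1 (u y) (v y) ∂ν := by
    intro W R u v hu hv h1 h2
    rw [hellingerDiv, ← h1, ← h2, homInt_withDensity hF ν hu hv
      (lintegral_ne_top_of_withDensity_eq h1) (lintegral_ne_top_of_withDensity_eq h2)]
  have hmean : ∀ (R : ProbabilityMeasure Y) (v : Y → ℝ≥0∞), Measurable v →
      ν.withDensity v = R → meanHellinger 1 P R = ∫⁻ y, ∑ w ∈ P.weights.support,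
        (P.weights w : ℝ≥0∞) * hellingerIntegrand 1 (f w y) (v y) ∂ν := by
    intro R v hv h
    have hφ : ∀ w, Measurable fun y => hellingerIntegrand 1 (f w y) (v y) := fun w =>
      hF.measurable.comp ((hfm w).prodMk hv)
    rw [lintegral_finsetSum _ fun w _ => (hφ w).const_mul _, meanHellinger]
    refine Finset.sum_congr rfl fun w hws => ?_
    rw [lintegral_const_mul _ (hφ w), hint _ _ _ _ (hfm w) hv (hw w hws) h]
  have hφS : Measurable fun y => hellingerIntegrand 1 (S y) (g y) :=
    hF.measurable.comp (hSm.prodMk hgm)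
  rw [hmean Q g hgm hQ, hmean _ S hSm hmix, hint _ _ S g hSm hgm hmix hQ,
    ← lintegral_add_left hφS]
  refine lintegral_congr_ae ?_
  filter_upwards [Measure.rnDeriv_ne_top (Q : Measure Y) ν,
    (Filter.eventually_all_finset P.weights.support).2 fun w _ =>
      Measure.rnDeriv_ne_top ((w : ProbabilityMeasure Y) : Measure Y) ν] with y h1 h2
  exact sum_mul_hellingerIntegrand_one _ (sum_weights P) h2 h1

lemma integrable_density_mul_log (P : Prior 𝒲) {w : 𝒲} (hw : w ∈ P.weights.support) :
    Integrable (fun y => (density P w y).toReal * Real.log (density P w y).toReal)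
      (mixture P) := by
  have hm : Measurable fun y => (density P w y).toReal := (measurable_density P w).ennreal_toReal
  refine Integrable.of_bound
    (hm.mul (Real.measurable_log.comp hm)).aestronglyMeasurable
    (1 + ((P.weights w : ℝ)⁻¹) ^ 2) ?_
  filter_upwards [density_le P hw] with y hy
  have hp : (P.weights w : ℝ≥0∞) ≠ 0 := by simpa using hw
  have hy' := ENNReal.toReal_mono (ENNReal.inv_ne_top.2 hp) hy
  rw [ENNReal.toReal_inv, ENNReal.coe_toReal] at hy'
  have hd : 0 ≤ (density P w y).toReal := ENNReal.toReal_nonneg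
  generalize (density P w y).toReal = x at *
  rw [Real.norm_eq_abs, abs_le]
  rcases hd.eq_or_lt with rfl | hx
  · rw [zero_mul]
    constructor
    · linarith [sq_nonneg ((P.weights w : ℝ)⁻¹)]
    · positivity
  have h1 : x * (1 - x⁻¹) ≤ x * Real.log x := by
    gcongr
    exact Real.one_sub_inv_le_log_of_pos hx
  have h2 : x * (1 - x⁻¹) = x - 1 := by field_simp
  have h3 : x * Real.log x ≤ x * x := by
    gcongr
    exact (Real.log_le_sub_one_of_pos hx).trans (by linarith)
  constructor <;> nlinarith [sq_nonneg ((P.weights w : ℝ)⁻¹)]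

open InformationTheory in
/-- The information of order one is the mean divergence from the mixture. -/
lemma renyiInfo_one (P : Prior 𝒲) :
    renyiInfo 1 P = (meanHellinger 1 P (renyiMean 1 P) : EReal) := by
  have hac : ∀ w ∈ P.weights.support,
      ((w : ProbabilityMeasure Y) : Measure Y) ≪ mixture P := fun w hw =>
    absolutelyContinuous_mixture P hw
  have hprob : IsProbabilityMeasure (mixture P) := coe_renyiMean_one P ▸ inferInstance
  have hfin : ∀ w ∈ P.weights.support,
      klDiv ((w : ProbabilityMeasure Y) : Measure Y) (mixture P) ≠ ∞ := by
    intro w hw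
    refine klDiv_ne_top (hac w hw) ?_
    rw [← integrable_rnDeriv_smul_iff (hac w hw)]
    exact integrable_density_mul_log P hw
  have hkl : ∀ w ∈ P.weights.support,
      ∫ y, (density P w y).toReal * Real.log (density P w y).toReal ∂(mixture P)
        = (klDiv ((w : ProbabilityMeasure Y) : Measure Y) (mixture P)).toReal := by
    intro w hw
    rw [toReal_klDiv_of_measure_eq (hac w hw) (by simp),
      ← integral_rnDeriv_smul (hac w hw)]
    rfl
  have hsum : ∫ y, ∑ w ∈ P.weights.support,
      posterior P w y * Real.log (posterior P w y / P.weights w) ∂(mixture P)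
      = ∑ w ∈ P.weights.support, (P.weights w : ℝ)
        * (klDiv ((w : ProbabilityMeasure Y) : Measure Y) (mixture P)).toReal := by
    have hterm : ∀ w ∈ P.weights.support, ∀ y,
        posterior P w y * Real.log (posterior P w y / P.weights w)
        = (P.weights w : ℝ) * ((density P w y).toReal * Real.log (density P w y).toReal) := by
      intro w hw y
      have hp : (P.weights w : ℝ) ≠ 0 := by simpa using hw
      rw [posterior, mul_div_cancel_left₀ _ hp, mul_assoc]
    calc _ = ∫ y, ∑ w ∈ P.weights.support, (P.weights w : ℝ)
          * ((density P w y).toReal * Real.log (density P w y).toReal) ∂(mixture P) := by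
          congr 1
          ext y
          exact Finset.sum_congr rfl fun w hw => hterm w hw y
      _ = _ := by
          rw [integral_finsetSum _ fun w hw => (integrable_density_mul_log P hw).const_mul _]
          refine Finset.sum_congr rfl fun w hw => ?_
          rw [integral_const_mul, hkl w hw]
  have hmean : meanHellinger 1 P (renyiMean 1 P) = ∑ w ∈ P.weights.support,
      (P.weights w : ℝ≥0∞)
        * klDiv ((w : ProbabilityMeasure Y) : Measure Y) (mixture P) := by
    simp only [meanHellinger, hellingerDiv_one, coe_renyiMean_one]
  have hterm : ∀ w ∈ P.weights.support, (P.weights w : ℝ≥0∞)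
      * klDiv ((w : ProbabilityMeasure Y) : Measure Y) (mixture P) ≠ ∞ :=
    fun w hw => ENNReal.mul_ne_top ENNReal.coe_ne_top (hfin w hw)
  rw [renyiInfo, if_neg ENNReal.one_ne_top, if_pos rfl, hsum, hmean,
    ← EReal.coe_toReal (x := ((∑ w ∈ P.weights.support, (P.weights w : ℝ≥0∞)
      * klDiv ((w : ProbabilityMeasure Y) : Measure Y) (mixture P) : ℝ≥0∞) : EReal))
      (by simpa using ENNReal.sum_ne_top.2 hterm) (by simp), EReal.toReal_coe_ennreal,
    ENNReal.toReal_sum hterm]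
  simp

/-- The Sibson identity: the joint divergence from a product measure splits into the information
and the divergence of the mean. -/
lemma jointDiv_eq_add (hα : 0 < α) (P : Prior 𝒲) (Q : ProbabilityMeasure Y) :
    jointDiv α P Q = renyiInfo α P + renyiDiv α (renyiMean α P) Q := by
  rcases eq_or_ne α ∞ with rfl | hα'
  · exact jointDiv_top_eq_add P Q
  rcases eq_or_ne α 1 with rfl | hα1
  · have h1 : ∀ {Ω : Type _} [MeasurableSpace Ω] (W R : ProbabilityMeasure Ω),
        renyiDiv 1 W R = (hellingerDiv 1 W R : EReal) := by
      intro Ω _ W R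
      rw [hellingerDiv_one]
      simp [renyiDiv]
    have h2 : jointDiv 1 P Q = (meanHellinger 1 P Q : EReal) := by
      rw [← hellingerDiv_joint one_pos, hellingerDiv_one]
      simp [renyiDiv, jointDiv]
    rw [h1, h2, renyiInfo_one, meanHellinger_one_eq_add, EReal.coe_ennreal_add, add_comm]
  · exact jointDiv_eq_add_of_ne_one hα hα' hα1 P Q

end Sibson

/-! ### The capacity and the center -/

section Center

variable {Y : Type*} [MeasurableSpace Y] {𝒲 : Set (ProbabilityMeasure Y)} {α : ℝ≥0∞}

lemma jointDiv_renyiMean (hα : 0 < α) (P : Prior 𝒲) :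
    jointDiv α P (renyiMean α P) = renyiInfo α P := by
  rw [jointDiv_eq_add hα, renyiDiv_self hα, add_zero]

lemma renyiInfo_le_jointDiv (hα : 0 < α) (P : Prior 𝒲) (Q : ProbabilityMeasure Y) :
    renyiInfo α P ≤ jointDiv α P Q := by
  rw [jointDiv_eq_add hα]
  exact le_add_of_nonneg_right (renyiDiv_nonneg hα _ _)

lemma renyiInfo_nonneg (hα : 0 < α) (P : Prior 𝒲) : 0 ≤ renyiInfo α P := by
  rw [← jointDiv_renyiMean hα]
  exact jointDiv_nonneg hα _ _

lemma renyiInfo_le_renyiCapacity (α : ℝ≥0∞) (P : Prior 𝒲) :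
    renyiInfo α P ≤ renyiCapacity α 𝒲 :=
  le_iSup (fun P : Prior 𝒲 => renyiInfo α P) P

lemma iInf_jointDiv (hα : 0 < α) (P : Prior 𝒲) :
    ⨅ Q : ProbabilityMeasure Y, jointDiv α P Q = renyiInfo α P :=
  le_antisymm ((iInf_le _ (renyiMean α P)).trans (jointDiv_renyiMean hα P).le)
    (le_iInf fun Q => renyiInfo_le_jointDiv hα P Q)

lemma iSup_jointDiv (hα : 0 < α) (Q : ProbabilityMeasure Y) :
    ⨆ P : Prior 𝒲, jointDiv α P Q = ⨆ W ∈ 𝒲, renyiDiv α W Q := by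
  refine le_antisymm (iSup_le fun P => ?_) (iSup₂_le fun W hW => ?_)
  · refine EReal.le_of_forall_lt_iff_le.1 fun c hc => jointDiv_le_coe hα P fun W hW => ?_
    exact (le_iSup₂ (f := fun W (_ : W ∈ 𝒲) => renyiDiv α W Q) W hW).trans hc.le
  · exact (renyiDiv_le_jointDiv_single hα ⟨W, hW⟩ Q).trans
      (le_iSup (fun P : Prior 𝒲 => jointDiv α P Q) _)

/-- The divergence of the mean of a prior is at most the deficit of its information. -/
lemma renyiDiv_renyiMean_le (hα : 0 < α) {P : Prior 𝒲} {Q : ProbabilityMeasure Y} {b c : ℝ}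
    (hJ : jointDiv α P Q ≤ (b : EReal)) (hI : (c : EReal) ≤ renyiInfo α P) :
    renyiDiv α (renyiMean α P) Q ≤ ((b - c : ℝ) : EReal) := by
  rw [EReal.coe_sub, EReal.le_sub_iff_add_le (by simp) (by simp), add_comm]
  refine le_trans ?_ hJ
  rw [jointDiv_eq_add hα]
  gcongr

/-- The mean `Q` of a suitable mixture of a nearly optimal prior `P₁` and any prior `P₂` is close to
the mean of `P₁`, and nearly attains the capacity as an upper bound for the divergence of `P₂`. -/
lemma exists_near_mean (hα : 0 < α) {C : ℝ} (hC : renyiCapacity α 𝒲 = (C : EReal)) (hC0 : 0 ≤ C)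
    {ε η : ℝ} (hε : 0 < ε) (hη : 0 < η) :
    ∃ δ : ℝ, 0 < δ ∧ ∀ P₁ P₂ : Prior 𝒲, ((C - δ : ℝ) : EReal) < renyiInfo α P₁ →
      ∃ Q : ProbabilityMeasure Y, tvDist (renyiMean α P₁) Q ≤ ε ∧
        jointDiv α P₂ Q ≤ ((C + η : ℝ) : EReal) ∧
        (((C - δ : ℝ) : EReal) < renyiInfo α P₂ → tvDist (renyiMean α P₂) Q ≤ ε) := by
  obtain ⟨κ, hκ, hpin⟩ := exists_tvDist_le_of_renyiDiv_le (Ω := Y) hα hε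
  obtain ⟨δ, hδ, mix, hmix⟩ := exists_mix_prior hα 𝒲 hC0 (η := min η (κ / 2)) (by positivity)
  have hδ1 : C - δ ≤ C - min δ (κ / 2) := by linarith [min_le_left δ (κ / 2)]
  refine ⟨min δ (κ / 2), by positivity, fun P₁ P₂ h₁ => ?_⟩
  have hQ : jointDiv α (mix P₁ P₂) (renyiMean α (mix P₁ P₂)) ≤ (C : EReal) := by
    rw [jointDiv_renyiMean hα, ← hC]
    exact renyiInfo_le_renyiCapacity α _
  obtain ⟨hJ₁, hJ₂⟩ := hmix P₁ P₂ _ hQ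
    ((EReal.coe_le_coe_iff.2 hδ1).trans_lt (h₁.trans_le (renyiInfo_le_jointDiv hα _ _)))
  have hclose : ∀ P : Prior 𝒲, jointDiv α P (renyiMean α (mix P₁ P₂))
      ≤ ((C + min η (κ / 2) : ℝ) : EReal) → ((C - min δ (κ / 2) : ℝ) : EReal) < renyiInfo α P →
      tvDist (renyiMean α P) (renyiMean α (mix P₁ P₂)) ≤ ε := by
    intro P hJ hI
    refine hpin _ _ ((renyiDiv_renyiMean_le hα hJ hI.le).trans (EReal.coe_le_coe_iff.2 ?_))
    linarith [min_le_right η (κ / 2), min_le_right δ (κ / 2)]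
  refine ⟨_, hclose P₁ hJ₁ h₁, hJ₂.trans (EReal.coe_le_coe_iff.2 ?_), hclose P₂ hJ₂⟩
  linarith [min_le_left η (κ / 2)]

lemma eventually_lt_renyiInfo {C : ℝ} {p : ℕ → Prior 𝒲}
    (hp : Tendsto (fun n => renyiInfo α (p n)) atTop (𝓝 (C : EReal))) {δ : ℝ} (hδ : 0 < δ) :
    ∃ N, ∀ n ≥ N, ((C - δ : ℝ) : EReal) < renyiInfo α (p n) :=
  eventually_atTop.1 (hp.eventually_const_lt (EReal.coe_lt_coe_iff.2 (by linarith)))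

lemma exists_tvDist_renyiMean_lt (hα : 0 < α) {C : ℝ} (hC : renyiCapacity α 𝒲 = (C : EReal))
    (hC0 : 0 ≤ C) {p : ℕ → Prior 𝒲}
    (hp : Tendsto (fun n => renyiInfo α (p n)) atTop (𝓝 (C : EReal))) :
    ∀ ε > 0, ∃ N : ℕ, ∀ m ≥ N, ∀ n ≥ N, tvDist (renyiMean α (p m)) (renyiMean α (p n)) < ε := by
  intro ε hε
  obtain ⟨δ, hδ, h⟩ := exists_near_mean hα hC hC0 (ε := ε / 3) (η := 1) (by positivity) one_pos
  obtain ⟨N, hN⟩ := eventually_lt_renyiInfo hp hδ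
  refine ⟨N, fun m hm n hn => ?_⟩
  obtain ⟨Q, h1, -, h2⟩ := h (p m) (p n) (hN m hm)
  have h3 := h2 (hN n hn)
  have h4 := tvDist_triangle (renyiMean α (p m)) Q (renyiMean α (p n))
  rw [tvDist_comm Q] at h4
  linarith

/-- A limit of the means of a maximizing sequence of priors bounds all divergences by the capacity:
it is also the limit of the means of mixtures of these priors with a point mass at `W`. -/
lemma renyiDiv_le_of_tendsto_renyiMean (hα : 0 < α) {C : ℝ}
    (hC : renyiCapacity α 𝒲 = (C : EReal)) (hC0 : 0 ≤ C) {p : ℕ → Prior 𝒲}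
    (hp : Tendsto (fun n => renyiInfo α (p n)) atTop (𝓝 (C : EReal))) {q : ProbabilityMeasure Y}
    (hq : Tendsto (fun n => tvDist (renyiMean α (p n)) q) atTop (𝓝 0))
    {W : ProbabilityMeasure Y} (hW : W ∈ 𝒲) : renyiDiv α W q ≤ (C : EReal) := by
  refine EReal.le_of_forall_lt_iff_le.1 fun c hc => ?_
  have hη : 0 < c - C := sub_pos.2 (EReal.coe_lt_coe_iff.1 hc)
  have hstep : ∀ k : ℕ, ∃ Q : ProbabilityMeasure Y,
      tvDist Q q ≤ 2 * (1 / ((k : ℝ) + 1)) ∧ renyiDiv α W Q ≤ (c : EReal) := by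
    intro k
    have hk : 0 < 1 / ((k : ℝ) + 1) := by positivity
    obtain ⟨δ, hδ, h⟩ := exists_near_mean hα hC hC0 hk hη
    obtain ⟨N, hN⟩ := eventually_lt_renyiInfo hp hδ
    obtain ⟨n, hn, hn'⟩ := ((hq.eventually_lt_const hk).and (eventually_ge_atTop N)).exists
    obtain ⟨Q, h1, h2, -⟩ := h (p n) (Convexity.StdSimplex.single ⟨W, hW⟩) (hN n hn')
    refine ⟨Q, ?_, ?_⟩
    · have h3 := tvDist_triangle Q (renyiMean α (p n)) q
      rw [tvDist_comm Q (renyiMean α (p n))] at h3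
      linarith
    · rw [add_sub_cancel] at h2
      exact (renyiDiv_le_jointDiv_single hα ⟨W, hW⟩ Q).trans h2
  choose Q hQ hD using hstep
  refine renyiDiv_le_of_tendsto hα (q := Q) ?_ hD
  refine squeeze_zero (fun _ => tvDist_nonneg _ _) hQ ?_
  simpa using (tendsto_one_div_add_atTop_nhds_zero_nat (𝕜 := ℝ)).const_mul 2

/-- If `q` bounds all joint divergences by the capacity, then the means of every maximizing sequence
of priors converge to `q`. -/
lemma tendsto_tvDist_renyiMean (hα : 0 < α) {C : ℝ} {p : ℕ → Prior 𝒲}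
    (hp : Tendsto (fun n => renyiInfo α (p n)) atTop (𝓝 (C : EReal))) {q : ProbabilityMeasure Y}
    (hq : ∀ P : Prior 𝒲, jointDiv α P q ≤ (C : EReal)) :
    Tendsto (fun n => tvDist (renyiMean α (p n)) q) atTop (𝓝 0) := by
  refine Metric.tendsto_atTop.2 fun ε hε => ?_
  obtain ⟨κ, hκ, hpin⟩ := exists_tvDist_le_of_renyiDiv_le (Ω := Y) hα (half_pos hε)
  obtain ⟨N, hN⟩ := eventually_lt_renyiInfo hp hκ
  refine ⟨N, fun n hn => ?_⟩
  rw [Real.dist_eq, sub_zero, abs_of_nonneg (tvDist_nonneg _ _)]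
  have h1 := renyiDiv_renyiMean_le hα (hq (p n)) (hN n hn).le
  rw [sub_sub_cancel] at h1
  linarith [hpin _ _ h1]

lemma eq_of_tendsto_tvDist {r : ℕ → ProbabilityMeasure Y} {Q R : ProbabilityMeasure Y}
    (hQ : Tendsto (fun n => tvDist (r n) Q) atTop (𝓝 0))
    (hR : Tendsto (fun n => tvDist (r n) R) atTop (𝓝 0)) : Q = R := by
  refine eq_of_tvDist_eq_zero (le_antisymm ?_ (tvDist_nonneg Q R))
  refine ge_of_tendsto' (x := atTop) (by simpa using hQ.add hR) fun n => ?_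
  rw [tvDist_comm (r n) Q]
  exact tvDist_triangle Q (r n) R

lemma exists_tendsto_renyiInfo (α : ℝ≥0∞) (h𝒲 : 𝒲.Nonempty) :
    ∃ p : ℕ → Prior 𝒲, Tendsto (fun n => renyiInfo α (p n)) atTop (𝓝 (renyiCapacity α 𝒲)) := by
  obtain ⟨W, hW⟩ := h𝒲
  obtain ⟨u, -, hu, hmem⟩ := exists_seq_tendsto_sSup
    (S := Set.range fun P : Prior 𝒲 => renyiInfo α P)
    ⟨_, Convexity.StdSimplex.single ⟨W, hW⟩, rfl⟩ (OrderTop.bddAbove _)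
  choose p hp using hmem
  exact ⟨p, by simp only [hp]; exact hu⟩

/-- A finite capacity is attained by a center. -/
lemma exists_center (hα : 0 < α) (h𝒲 : 𝒲.Nonempty) {C : ℝ}
    (hC : renyiCapacity α 𝒲 = (C : EReal)) (hC0 : 0 ≤ C) :
    ∃ q : ProbabilityMeasure Y, ∀ W ∈ 𝒲, renyiDiv α W q ≤ (C : EReal) := by
  obtain ⟨p, hp⟩ := exists_tendsto_renyiInfo α h𝒲
  rw [hC] at hp
  obtain ⟨q, hq⟩ := exists_tendsto_tvDist (exists_tvDist_renyiMean_lt hα hC hC0 hp)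
  exact ⟨q, fun W hW => renyiDiv_le_of_tendsto_renyiMean hα hC hC0 hp hq hW⟩

lemma exists_coe_eq_renyiCapacity (hα : 0 < α) (h𝒲 : 𝒲.Nonempty) (h : renyiCapacity α 𝒲 < ⊤) :
    ∃ C : ℝ, renyiCapacity α 𝒲 = (C : EReal) ∧ 0 ≤ C := by
  obtain ⟨W, hW⟩ := h𝒲
  have h0 : 0 ≤ renyiCapacity α 𝒲 :=
    (renyiInfo_nonneg hα (Convexity.StdSimplex.single ⟨W, hW⟩ : Prior 𝒲)).trans
      (renyiInfo_le_renyiCapacity α _)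
  refine ⟨(renyiCapacity α 𝒲).toReal, (EReal.coe_toReal h.ne ?_).symm, EReal.toReal_nonneg h0⟩
  exact (EReal.bot_lt_zero.trans_le h0).ne'

end Center

end Renyi

end

open Renyi
theorem theorem1 {Y : Type*} [MeasurableSpace Y] (α : ℝ≥0∞) (hα : 0 < α)
    (𝒲 : Set (ProbabilityMeasure Y)) (h𝒲 : 𝒲.Nonempty) :
    renyiCapacity α 𝒲 = (⨆ P : Prior 𝒲, ⨅ Q : ProbabilityMeasure Y, jointDiv α P Q) ∧
    renyiCapacity α 𝒲 = (⨅ Q : ProbabilityMeasure Y, ⨆ P : Prior 𝒲, jointDiv α P Q) ∧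
    renyiCapacity α 𝒲 = (⨅ Q : ProbabilityMeasure Y, ⨆ W ∈ 𝒲, renyiDiv α W Q) ∧
    (renyiCapacity α 𝒲 < ⊤ →
      ∃ q : ProbabilityMeasure Y,
        renyiCapacity α 𝒲 = (⨆ P : Prior 𝒲, jointDiv α P q) ∧
        renyiCapacity α 𝒲 = (⨆ W ∈ 𝒲, renyiDiv α W q) ∧
        (∀ Q : ProbabilityMeasure Y,
          renyiCapacity α 𝒲 = (⨆ P : Prior 𝒲, jointDiv α P Q) → Q = q) ∧
        (∀ Q : ProbabilityMeasure Y,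
          renyiCapacity α 𝒲 = (⨆ W ∈ 𝒲, renyiDiv α W Q) → Q = q) ∧
        ∀ p : ℕ → Prior 𝒲,
          Tendsto (fun n => renyiInfo α (p n)) atTop (𝓝 (renyiCapacity α 𝒲)) →
            (∀ ε > 0, ∃ N : ℕ, ∀ m ≥ N, ∀ n ≥ N,
              tvDist (renyiMean α (p m)) (renyiMean α (p n)) < ε) ∧
            ∀ Q : ProbabilityMeasure Y,
              Tendsto (fun n => tvDist (renyiMean α (p n)) Q) atTop (𝓝 0) ↔ Q = q) := by
  have hsup := iSup_jointDiv (𝒲 := 𝒲) hα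
  have hle : ∀ Q : ProbabilityMeasure Y,
      renyiCapacity α 𝒲 ≤ ⨆ P : Prior 𝒲, jointDiv α P Q := fun Q =>
    iSup_mono fun P => renyiInfo_le_jointDiv hα P Q
  have hinf : renyiCapacity α 𝒲 = ⨅ Q : ProbabilityMeasure Y, ⨆ P : Prior 𝒲, jointDiv α P Q := by
    refine le_antisymm (le_iInf hle) ?_
    rcases eq_top_or_lt_top (renyiCapacity α 𝒲) with h | h
    · rw [h]; exact le_top
    · obtain ⟨C, hC, hC0⟩ := exists_coe_eq_renyiCapacity hα h𝒲 h
      obtain ⟨q, hq⟩ := exists_center hα h𝒲 hC hC0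
      rw [hC]
      exact (iInf_le _ q).trans (iSup_le fun P => jointDiv_le_coe hα P hq)
  refine ⟨?_, hinf, ?_, fun h => ?_⟩
  · simp only [iInf_jointDiv hα, renyiCapacity]
  · simp only [← hsup, hinf]
  obtain ⟨C, hC, hC0⟩ := exists_coe_eq_renyiCapacity hα h𝒲 h
  obtain ⟨q, hq⟩ := exists_center hα h𝒲 hC hC0
  have hqJ : ∀ P : Prior 𝒲, jointDiv α P q ≤ (C : EReal) := fun P => jointDiv_le_coe hα P hq
  have hq_eq : renyiCapacity α 𝒲 = ⨆ P : Prior 𝒲, jointDiv α P q :=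
    le_antisymm (hle q) (hC ▸ iSup_le hqJ)
  have huniq : ∀ Q : ProbabilityMeasure Y,
      renyiCapacity α 𝒲 = (⨆ P : Prior 𝒲, jointDiv α P Q) → Q = q := by
    intro Q hQ
    obtain ⟨p, hp⟩ := exists_tendsto_renyiInfo α h𝒲
    rw [hC] at hp
    refine eq_of_tendsto_tvDist (tendsto_tvDist_renyiMean hα hp fun P => ?_)
      (tendsto_tvDist_renyiMean hα hp hqJ)
    rw [← hC, hQ]
    exact le_iSup (fun P : Prior 𝒲 => jointDiv α P Q) P
  refine ⟨q, hq_eq, hsup q ▸ hq_eq, huniq, fun Q hQ => huniq Q (by rw [hsup Q]; exact hQ),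
    fun p hp => ?_⟩
  rw [hC] at hp
  have hlim := tendsto_tvDist_renyiMean hα hp hqJ
  exact ⟨exists_tvDist_renyiMean_lt hα hC hC0 hp,
    fun Q => ⟨fun hQ => eq_of_tendsto_tvDist hQ hlim, fun hQ => hQ ▸ hlim⟩⟩
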